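/- Let $\Omega$ be the space of $C^3$ functions $h:\mathbb{R}^2\to\mathbb{R}$ with the Fréchet topology of locally uniform convergence of derivatives of order at most $3$, given by the seminorms $\|f\|_N=\sup_{|x|\le N}\sum_{k\le 3}|\nabla^k f(x)|$, and let $\tau_x h=h(\cdot+x)$. Let $\mathbb{P}$ be a Borel probability measure on $\Omega$ such that - (stationarity) $\mathbb{P}(\tau_x^{-1}B)=\mathbb{P}(B)$ for all Borel $B$ and all $x\in\mathbb{R}^2$; - (ergodicity) every Borel $B$ with $\tau_x(B)=B$ for all $x$ has $\mathbb{P}(B)\in\{0,1\}$; - (stochastic continuity) $\lim_{x\to0}\mathbb{P}(\|\tau_xh-h\|_N>\delta)=0$ for all $\delta>0$ and $N\in\mathbb{N}$; - (bounds) there is $K>0$ such that, $\mathbb{P}$-almost surely, $|\nabla h(x)|+|\nabla\nabla h(x)|\le K$ for all $x\in\mathbb{R}^2$. Put $g(x,h)=I+\nabla h(x)\otimes\nabla h(x)$, $|g|=\det g$, $g(h)=g(0,h)$, $Z=\int_\Omega\sqrt{|g|(h)}\,\mathbb{P}(dh)$, $\pi(dh)=Z^{-1}\sqrt{|g|(h)}\,\mathbb{P}(dh)$,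 and let $F(h)=|g|^{-1/2}\,\nabla\cdot(\sqrt{|g|}\,g^{-1})(x,h)\big|_{x=0}$. Let $D_i$ be the generator in $L^2(\mathbb{P})$ of the translations in direction $e_i$, $\mathbb{D}=(D_1,D_2)$, $H^1=\mathcal{D}(D_1)\cap\mathcal{D}(D_2)$, and let $\mathcal{L}=|g|^{-1/2}\,\mathbb{D}\cdot(\sqrt{|g|}\,g^{-1}\mathbb{D})$ be the self-adjoint operator in $L^2(\pi)$ associated with the form $\frac1Z\int_\Omega\mathbb{D}u\cdot g^{-1}\mathbb{D}v\,\sqrt{|g|}\,d\mathbb{P}$ on $H^1$. For a unit vector $e$ and $\lambda>0$ let $\chi^e_\lambda$ solve $(\lambda-\mathcal{L})\chi^e_\lambda=F\cdot e$, and let $\mathbb{D}\chi^e$ be the limit of $\mathbb{D}\chi^e_\lambda$ as $\lambda\downarrow0$ in the energy norm $\left(\frac1Z\int_\Omega V\cdot g^{-1}V\sqrt{|g|}\,d\mathbb{P}\right)^{1/2}$ on square-integrable vector fields $V$. The effective diffusion tensor is $$D=\frac1Z\int_\Omega(I+\mathbb{D}\chi)\,g^{-1}\,(I+\mathbb{D}\chi)^\top\sqrt{|g|}\,d\mathbb{P},\qquad(\mathbb{D}\chi)_{ij}=D_j\chi^{e_i}.$$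 **Theorem.** Let $Q\in\mathbb{R}^{2\times2}$ be the matrix of the rotation by an angle $\theta$ with $\theta\not\equiv0$ and $\theta\not\equiv\pi$ modulo $2\pi$, let $c\in\mathbb{R}^2$, and suppose that $\mathbb{P}$ is invariant under the map $h\mapsto h\big(c+Q^\top(\cdot-c)\big)$ on $\Omega$ induced by the rotation about $c$ (for $c=0$ this is $h\mapsto h(Q^\top\cdot)$). Then $D$ is well defined (the limits above exist and determine a unique matrix), $D=QDQ^\top$, and $D$ is isotropic, i.e. a scalar multiple of $I$; more precisely, $D=\frac1Z I$. -/

import Mathlib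

open MeasureTheory Filter Topology
open scoped Matrix

noncomputable section

namespace RandomSurface

/-- The plane `ℝ²` with its Euclidean norm. -/
abbrev Plane : Type := EuclideanSpace ℝ (Fin 2)

/-- The coordinate vector `e_i`. -/
def basisVec (i : Fin 2) : Plane := EuclideanSpace.single i 1

/-- The space `Ω` of `C³` functions `ℝ² → ℝ` (the realisations of the random field). -/
def Field : Type := {h : Plane → ℝ // ContDiff ℝ 3 h}

instance : CoeFun Field (fun _ => Plane → ℝ) := ⟨Subtype.val⟩

/-- The derivatives of order at most three of a realisation, as continuous maps. -/
def Field.jet (h : Field) (k : Fin 4) : C(Plane, Plane [×(k : ℕ)]→L[ℝ] ℝ) where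
  toFun := iteratedFDeriv ℝ (k : ℕ) h
  continuous_toFun := h.2.continuous_iteratedFDeriv (by
    have h3 : ((k : ℕ) : ℕ∞) ≤ (3 : ℕ) := by exact_mod_cast Nat.lt_succ_iff.mp k.2
    exact_mod_cast h3)

/-- The Fréchet topology of `C³`: locally uniform convergence of all derivatives of order at most
three, which is the topology of the seminorms `localNorm N` below
(`C(_, _)` carries the topology of uniform convergence on compact sets). -/
instance : TopologicalSpace Field :=
  TopologicalSpace.induced Field.jet inferInstance

/-- The Borel `σ`-algebra of `Ω`. -/
instance : MeasurableSpace Field := borel Field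

instance : BorelSpace Field := ⟨rfl⟩

/-- The seminorm `‖f‖_N = sup_{|x| ≤ N} ∑_{k ≤ 3} |∇ᵏ f(x)|`. -/
def localNorm (N : ℕ) (f : Plane → ℝ) : ℝ :=
  ⨆ x : Metric.closedBall (0 : Plane) (N : ℝ),
    ∑ k ∈ Finset.range 4, ‖iteratedFDeriv ℝ k f (x : Plane)‖

/-- The translation `τ_x h = h(· + x)`. -/
def translate (x : Plane) (h : Field) : Field :=
  ⟨fun y => h (y + x), h.2.comp (contDiff_id.add contDiff_const)⟩

/-- The standing assumptions on the law `P` of the random field. -/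
structure IsAdmissible (P : Measure Field) : Prop where
  /-- `P` is a probability measure. -/
  prob : IsProbabilityMeasure P
  /-- Stationarity. -/
  stationary : ∀ (x : Plane) (B : Set Field), MeasurableSet B → P (translate x ⁻¹' B) = P B
  /-- Ergodicity with respect to the translations. -/
  ergodic : ∀ B : Set Field, MeasurableSet B → (∀ x, translate x '' B = B) → P B = 0 ∨ P B = 1
  /-- Stochastic continuity: `τ_x h → h` in probability as `x → 0`. -/
  stochCont : ∀ (N : ℕ) (δ : ℝ), 0 < δ →
    Tendsto (fun x : Plane => P {h : Field | δ < localNorm N (fun y => translate x h y - h y)})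
      (𝓝 0) (𝓝 0)
  /-- Almost surely uniform bounds on the first two derivatives. -/
  bounded : ∃ K : ℝ, 0 < K ∧
    ∀ᵐ h : Field ∂P, ∀ x : Plane, ‖gradient h x‖ + ‖fderiv ℝ (gradient h) x‖ ≤ K

/-- The metric tensor `g(x, h) = I + ∇h(x) ⊗ ∇h(x)`. -/
def metric (h : Field) (x : Plane) : Matrix (Fin 2) (Fin 2) ℝ :=
  1 + Matrix.vecMulVec (gradient h x).ofLp (gradient h x).ofLp

/-- The surface element `√|g|(x, h)`, where `|g| = det g`. -/
def areaElement (h : Field) (x : Plane) : ℝ := √(metric h x).det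

/-- The average surface area `Z = E_P[√|g|(0, h)]`. -/
def avgArea (P : Measure Field) : ℝ := ∫ h, areaElement h 0 ∂P

/-- The probability measure `π(dh) = √|g|(h) / Z P(dh)`. -/
def envMeasure (P : Measure Field) : Measure Field :=
  P.withDensity (fun h => ENNReal.ofReal (areaElement h 0 / avgArea P))

/-- The drift `F(h) = |g|^{-1/2} ∇ · (√|g| g⁻¹)` at `x = 0`, with components
`F_i = |g|^{-1/2} ∑_j ∂_j (√|g| g⁻¹)_{ij}`. -/
def drift (h : Field) : Plane :=
  WithLp.toLp 2 fun i =>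
    (areaElement h 0)⁻¹ *
      ∑ j, fderiv ℝ (fun x => areaElement h x * (metric h x)⁻¹ i j) 0 (basisVec j)

/-- `u ∈ H¹ = ⋂ᵢ 𝒟(D_i)` and `G = 𝔻u = (D₁u, D₂u)`, where `D_i` is the derivative in `L²(P)` along
the translations in direction `e_i`:
`(u ∘ τ_{s e_i} - u) / s → D_i u` in `L²(P)` as `s → 0`. -/
structure HasGrad (P : Measure Field) (u : Field → ℝ) (G : Field → Plane) : Prop where
  memLp_fun : MemLp u 2 P
  memLp_grad : MemLp G 2 P
  tendsto : ∀ i : Fin 2, Tendsto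
    (fun s : ℝ => eLpNorm (fun h => s⁻¹ * (u (translate (s • basisVec i) h) - u h) - G h i) 2 P)
    (𝓝[≠] 0) (𝓝 0)

/-- The Dirichlet form of the environment process, as a bilinear form of the gradients:
`(1/Z) ∫ G · g⁻¹ G' √|g| dP`. -/
def dirichletForm (P : Measure Field) (G G' : Field → Plane) : ℝ :=
  (avgArea P)⁻¹ *
    ∫ h, ((G h).ofLp ⬝ᵥ ((metric h 0)⁻¹ *ᵥ (G' h).ofLp)) * areaElement h 0 ∂P

/-- `u ∈ 𝒟(ℒ)` and `ℒ u = f`, where `ℒ`, the self-adjoint realisation in `L²(π)` of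
`|g|^{-1/2} 𝔻 · (√|g| g⁻¹ 𝔻 u)`, is the operator of the Dirichlet form with domain `H¹`:
`⟨-ℒu, ψ⟩_{L²(π)} = (1/Z) ∫ 𝔻u · g⁻¹ 𝔻ψ √|g| dP` for all `ψ ∈ H¹`. -/
def IsGenerator (P : Measure Field) (u f : Field → ℝ) : Prop :=
  MemLp f 2 (envMeasure P) ∧
  ∃ G, HasGrad P u G ∧ ∀ ψ Gψ, HasGrad P ψ Gψ →
    ∫ h, (- f h) * ψ h ∂(envMeasure P) = dirichletForm P G Gψ

/-- The resolvent equation `(l - ℒ) χ = F · e` for the corrector `χ = χ_l^e`, with parameter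
`l > 0`. -/
def IsResolventCorrector (P : Measure Field) (l : ℝ) (e : Plane) (χ : Field → ℝ) : Prop :=
  IsGenerator P χ (fun h => l * χ h - inner ℝ (drift h) e)

/-- `V = 𝔻χ^e`, where `χ^e` is the limit of the correctors `χ_l^e` as `l ↓ 0` in the completion
`ℋ₁` of the energy norm `‖φ‖₁² = ⟨-ℒφ, φ⟩_{L²(π)}`. An element of the completion is represented
by its gradient, a square integrable vector field. -/
def IsCorrectorGradient (P : Measure Field) (e : Plane) (V : Field → Plane) : Prop :=
  MemLp V 2 P ∧
  ∃ (χ : ℝ → Field → ℝ) (G : ℝ → Field → Plane),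
    (∀ l : ℝ, 0 < l → IsResolventCorrector P l e (χ l) ∧ HasGrad P (χ l) (G l)) ∧
    Tendsto (fun l => dirichletForm P (fun h => G l h - V h) (fun h => G l h - V h))
      (𝓝[>] 0) (𝓝 0)

/-- The matrix `𝔻χ` with `(𝔻χ)_{ij} = D_j χ^{e_i}`, whose rows are the gradients `V i = 𝔻χ^{e_i}`. -/
def gradMatrix (V : Fin 2 → Field → Plane) (h : Field) : Matrix (Fin 2) (Fin 2) ℝ :=
  Matrix.of fun i j => V i h j

/-- The integrand `(I + 𝔻χ) g⁻¹ (I + 𝔻χ)ᵀ √|g|` of the effective diffusion tensor. -/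
def diffusionIntegrand (V : Fin 2 → Field → Plane) (h : Field) : Matrix (Fin 2) (Fin 2) ℝ :=
  areaElement h 0 • ((1 + gradMatrix V h) * (metric h 0)⁻¹ * (1 + gradMatrix V h)ᵀ)

/-- `D` is the effective diffusion tensor
`D = (1/Z) ∫ (I + 𝔻χ) g⁻¹ (I + 𝔻χ)ᵀ √|g| dP`. -/
def IsEffectiveDiffusion (P : Measure Field) (D : Matrix (Fin 2) (Fin 2) ℝ) : Prop :=
  ∃ V : Fin 2 → Field → Plane, (∀ i, IsCorrectorGradient P (basisVec i) (V i)) ∧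
    ∀ i j, D i j = (avgArea P)⁻¹ * ∫ h, diffusionIntegrand V h i j ∂P

/-- The matrix of the rotation by the angle `θ`. -/
def rotMatrix (θ : Real.Angle) : Matrix (Fin 2) (Fin 2) ℝ :=
  !![θ.cos, -θ.sin; θ.sin, θ.cos]

/-- The operator `h ↦ h(Qᵀ ·)` for the rotation about the point `c` with matrix `Q`:
`h ↦ h(c + Qᵀ (· - c))`. -/
def rotate (Q : Matrix (Fin 2) (Fin 2) ℝ) (c : Plane) (h : Field) : Field :=
  ⟨fun x => h (c + Matrix.toEuclideanCLM (𝕜 := ℝ) Qᵀ (x - c)),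
    h.2.comp (contDiff_const.add
      ((ContinuousLinearMap.contDiff _).comp (contDiff_id.sub contDiff_const)))⟩

end RandomSurface

end

/-!
The homogenized matrix is `Z D`, with entries `⟨e_i + V_i, A (e_j + V_j)⟩` in `L²(P; ℝ²)`, where `A`
is the multiplication by `√|g| g⁻¹` and `V_i = 𝔻χ^{e_i}` is the potential field (a limit of
gradients of elements of `H¹`) for which `A (e_i + V_i)` is divergence-free. The value `Z D = I` has
two sources.

*Isotropy.* A rotation `R` that preserves `P` acts on vector fields by `V ↦ Qᵀ (V ∘ R)`. This action
preserves potential fields and the energy, because `√|g| g⁻¹` is covariant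
(`envCoeff_originRotate`), and maps the constant field `ξ` to `Qᵀ ξ`. As `ξ · Z D ξ` is the minimum
of the energy over the potential perturbations of `ξ`, it does not increase under `Qᵀ`, and in
dimension two this leaves only multiples of `I` when `sin θ ≠ 0` (`isotropic_of_symmetry`). By
stationarity the centre of the rotation may be taken to be the origin.

*Keller–Dykhne duality.* In dimension two `det (√|g| g⁻¹) = 1`, so that `A J A = J` for the rotation
`J` by a right angle. Moreover `J` exchanges divergence-free and curl-free fields, and curl-free
fields of mean zero are potential (`mem_potential_of_curl`). Hence the turned flux `J A (e_0 + V_0)`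
is again a corrector field, and comparing energies forces `Z D = α I` to satisfy `α³ = α` with
`α > 0` (`eq_one_of_duality`).

All of this takes place in the Hilbert space `L²(P)` with the strongly continuous unitary group of
translations (`isUnitaryRep_shift`); strong continuity comes from the continuity of
`x ↦ τ_x h` in the topology of `C³`. Ergodicity enters through the fact that invariant elements
of `L²(P)` are constant (`exists_eq_smul_oneLp`). The correctors `χ_l^e` exist by the Lax–Milgram
theorem on the graph of the gradient, the drift being a divergence in the weak sense
(`inner_envOp_constField`), and their gradients converge in energy to `V` (`tendsto_resolvent`).
Thus the limits in the definition of `D` exist and are unique (`isCorrectorGradient_iff`).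
-/

noncomputable section

namespace RandomSurface

/-! ### Lax–Milgram on a closed subspace -/

section LaxMilgram

variable {E : Type*} [NormedAddCommGroup E] [InnerProductSpace ℝ E] [CompleteSpace E]

/-- The Lax–Milgram theorem for a coercive operator, posed on a closed subspace. -/
theorem exists_mem_forall_inner_eq (K : Submodule ℝ E) (hK : IsClosed (K : Set E))
    (B : E →L[ℝ] E) {c : ℝ} (hc : 0 < c) (hB : ∀ x, c * ‖x‖ ^ 2 ≤ inner ℝ x (B x)) (b : E) :
    ∃ u ∈ K, ∀ v ∈ K, inner ℝ v (B u) = inner ℝ v b := by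
  have : CompleteSpace K := hK.completeSpace_coe
  let β : K →L[ℝ] K →L[ℝ] ℝ := (innerSL ℝ).bilinearComp (B ∘L K.subtypeL) K.subtypeL
  have hβ : IsCoercive β := by
    refine ⟨c, hc, fun u => ?_⟩
    have h := hB u
    rw [real_inner_comm] at h
    calc c * ‖u‖ * ‖u‖ = c * ‖(u : E)‖ ^ 2 := by rw [Submodule.coe_norm]; ring
      _ ≤ _ := h
  let r : K := (InnerProductSpace.toDual ℝ K).symm ((innerSL ℝ b) ∘L K.subtypeL)
  let u : K := hβ.continuousLinearEquivOfBilin.symm r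
  refine ⟨u, u.2, fun v hv => ?_⟩
  have h1 := hβ.continuousLinearEquivOfBilin_apply u ⟨v, hv⟩
  have h2 : inner ℝ r (⟨v, hv⟩ : K) = inner ℝ b v :=
    InnerProductSpace.toDual_symm_apply
  rw [show hβ.continuousLinearEquivOfBilin u = r from
    hβ.continuousLinearEquivOfBilin.apply_symm_apply r, h2] at h1
  rw [real_inner_comm, real_inner_comm b v, h1]
  rfl

end LaxMilgram

/-! ### Unitary groups indexed by the plane, gradients and potential fields -/

section Group

variable {H : Type*} [NormedAddCommGroup H] [InnerProductSpace ℝ H]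

/-- A strongly continuous group of isometries of a Hilbert space, indexed by the plane. -/
structure IsUnitaryRep (U : Plane → H →L[ℝ] H) : Prop where
  map_zero : ∀ f, U 0 f = f
  map_add : ∀ x y f, U (x + y) f = U x (U y f)
  norm_map : ∀ x f, ‖U x f‖ = ‖f‖
  continuous : ∀ f, Continuous fun x => U x f

/-- `u` is in the domain of the generator of `s ↦ U (s • x)`, which maps it to `w`. -/
def IsGen (U : Plane → H →L[ℝ] H) (x : Plane) (u w : H) : Prop :=
  HasDerivAt (fun s : ℝ => U (s • x) u) w 0

variable {U : Plane → H →L[ℝ] H}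

namespace IsUnitaryRep

theorem inner_map_map (hU : IsUnitaryRep U) (x : Plane) (f g : H) :
    inner ℝ (U x f) (U x g) = inner ℝ f g :=
  LinearIsometry.inner_map_map ⟨(U x : H →ₗ[ℝ] H), hU.norm_map x⟩ f g

theorem map_comm (hU : IsUnitaryRep U) (x y : Plane) (f : H) : U x (U y f) = U y (U x f) := by
  rw [← hU.map_add, ← hU.map_add, add_comm]

theorem map_neg_map (hU : IsUnitaryRep U) (x : Plane) (f : H) : U (-x) (U x f) = f := by
  rw [← hU.map_add, neg_add_cancel, hU.map_zero]

theorem inner_map_left (hU : IsUnitaryRep U) (x : Plane) (f g : H) :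
    inner ℝ (U x f) g = inner ℝ f (U (-x) g) := by
  rw [← hU.inner_map_map (-x) (U x f) g, hU.map_neg_map]

/-- Strong continuity is joint, as the operators are isometries. -/
theorem tendsto_map (hU : IsUnitaryRep U) {α : Type*} {l : Filter α} {x : α → Plane} {x₀ : Plane}
    {f : α → H} {f₀ : H} (hx : Tendsto x l (𝓝 x₀)) (hf : Tendsto f l (𝓝 f₀)) :
    Tendsto (fun a => U (x a) (f a)) l (𝓝 (U x₀ f₀)) := by
  have h1 : Tendsto (fun a => U (x a) f₀) l (𝓝 (U x₀ f₀)) :=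
    ((hU.continuous f₀).tendsto x₀).comp hx
  have h2 : Tendsto (fun a => U (x a) (f a - f₀)) l (𝓝 0) := by
    rw [tendsto_zero_iff_norm_tendsto_zero]
    simp only [hU.norm_map]
    rw [← tendsto_zero_iff_norm_tendsto_zero]
    simpa using hf.sub_const f₀
  simpa using h2.add h1

/-- The derivative of an orbit at any time. -/
theorem hasDerivAt_orbit (hU : IsUnitaryRep U) {x : Plane} {u w : H} (h : IsGen U x u w) (s : ℝ) :
    HasDerivAt (fun s : ℝ => U (s • x) u) (U (s • x) w) s := by
  have h0 : HasDerivAt (fun t : ℝ => U (t • x) u) w (s - s) := by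
    rw [sub_self]; exact h
  have h1 := (U (s • x)).hasFDerivAt.comp_hasDerivAt s (h0.comp_sub_const s s)
  refine h1.congr_of_eventuallyEq (Eventually.of_forall fun t => ?_)
  change U (t • x) u = U (s • x) (U ((t - s) • x) u)
  rw [← hU.map_add, ← add_smul, add_sub_cancel]

theorem map_eq_of_isGen_zero (hU : IsUnitaryRep U) {x : Plane} {u : H} (h : IsGen U x u 0)
    (s : ℝ) : U (s • x) u = u := by
  have h1 : ∀ s, HasDerivAt (fun s : ℝ => U (s • x) u) 0 s := fun s => by
    simpa using hU.hasDerivAt_orbit h s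
  have h2 := is_const_of_deriv_eq_zero (fun s => (h1 s).differentiableAt)
    (fun s => (h1 s).deriv) s 0
  simpa [hU.map_zero] using h2

end IsUnitaryRep

theorem isGen_iff_tendsto (hU : IsUnitaryRep U) {x : Plane} {u w : H} : IsGen U x u w ↔
    Tendsto (fun s : ℝ => s⁻¹ • (U (s • x) u - u)) (𝓝[≠] 0) (𝓝 w) := by
  rw [IsGen, hasDerivAt_iff_tendsto_slope_zero]
  simp [hU.map_zero]

theorem IsGen.tendsto {x : Plane} {u w : H} (hU : IsUnitaryRep U) (h : IsGen U x u w) :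
    Tendsto (fun s : ℝ => s⁻¹ • (U (s • x) u - u)) (𝓝[≠] 0) (𝓝 w) :=
  (isGen_iff_tendsto hU).1 h

theorem IsGen.unique {x : Plane} {u w w' : H} (h : IsGen U x u w) (h' : IsGen U x u w') :
    w = w' := HasDerivAt.unique h h'

/-- A bounded operator that commutes with the group commutes with its generators. -/
theorem IsGen.map {x : Plane} {u w : H} (h : IsGen U x u w) (M : H →L[ℝ] H)
    (hM : ∀ y f, M (U y f) = U y (M f)) : IsGen U x (M u) (M w) := by
  have := M.hasFDerivAt.comp_hasDerivAt 0 h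
  refine this.congr_of_eventuallyEq (Eventually.of_forall fun t => ?_)
  exact (hM _ _).symm

theorem IsGen.smul_dir {x : Plane} {u w : H} (h : IsGen U x u w) (c : ℝ) :
    IsGen U (c • x) u (c • w) := by
  have h0 : HasDerivAt (fun s : ℝ => U (s • x) u) w (0 * c) := by rw [zero_mul]; exact h
  have h1 := h0.scomp (0 : ℝ) ((hasDerivAt_id (0 : ℝ)).mul_const c)
  rw [one_mul] at h1
  refine h1.congr_of_eventuallyEq (Eventually.of_forall fun t => ?_)
  change U (t • c • x) u = U ((t * c) • x) u
  rw [smul_smul]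

theorem IsGen.add_dir (hU : IsUnitaryRep U) {x y : Plane} {u w z : H} (hx : IsGen U x u w)
    (hy : IsGen U y u z) : IsGen U (x + y) u (w + z) := by
  rw [isGen_iff_tendsto hU] at *
  have h0 : Tendsto (fun s : ℝ => s • x) (𝓝[≠] 0) (𝓝 0) := by
    have : Tendsto (fun s : ℝ => s • x) (𝓝 0) (𝓝 ((0 : ℝ) • x)) :=
      (continuous_id.smul continuous_const).tendsto 0
    rw [zero_smul] at this
    exact this.mono_left nhdsWithin_le_nhds
  have h1 := hU.tendsto_map h0 hy
  rw [hU.map_zero] at h1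
  refine (hx.add h1).congr fun s => ?_
  rw [map_smul, ← smul_add, map_sub, smul_add s x y, hU.map_add]
  congr 1
  abel

/-- The generators are skew-adjoint. -/
theorem IsGen.inner_skew (hU : IsUnitaryRep U) {x : Plane} {u w v z : H} (hu : IsGen U x u w)
    (hv : IsGen U x v z) : inner ℝ w v = - inner ℝ u z := by
  have h : HasDerivAt (fun s : ℝ => inner ℝ (U (s • x) u) (U (s • x) v)) _ 0 := hu.inner ℝ hv
  have h' : HasDerivAt (fun s : ℝ => inner ℝ (U (s • x) u) (U (s • x) v)) (0 : ℝ) 0 := by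
    simp only [hU.inner_map_map]
    exact hasDerivAt_const _ _
  have := h.unique h'
  simp only [zero_smul, hU.map_zero] at this
  linarith

/-- Weak equality of mixed derivatives: `⟨D_x a, D_y b⟩ = ⟨D_y a, D_x b⟩`, already for `a` and `b`
with first derivatives only. It holds for difference quotients because the group is commutative. -/
theorem IsGen.inner_comm (hU : IsUnitaryRep U) {x y : Plane} {a b a₁ a₂ b₁ b₂ : H}
    (ha₁ : IsGen U x a a₁) (ha₂ : IsGen U y a a₂) (hb₁ : IsGen U x b b₁) (hb₂ : IsGen U y b b₂) :
    inner ℝ a₁ b₂ = inner ℝ a₂ b₁ := by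
  have hneg : Tendsto (fun s : ℝ => -s) (𝓝[≠] 0) (𝓝[≠] 0) := by
    refine tendsto_nhdsWithin_of_tendsto_nhds_of_eventually_within _ ?_ ?_
    · have : Tendsto (fun s : ℝ => -s) (𝓝 0) (𝓝 (-0)) := continuous_neg.tendsto 0
      rw [neg_zero] at this
      exact this.mono_left nhdsWithin_le_nhds
    · filter_upwards [self_mem_nhdsWithin] with s hs
      simpa using hs
  have h1 := (ha₁.tendsto hU).inner (𝕜 := ℝ) (hb₂.tendsto hU)
  have h2 := ((ha₂.tendsto hU).comp hneg).inner (𝕜 := ℝ) ((hb₁.tendsto hU).comp hneg)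
  refine tendsto_nhds_unique h1 (h2.congr fun s => ?_)
  simp only [Function.comp_apply, inner_smul_left, inner_smul_right, inner_sub_left,
    inner_sub_right, neg_smul]
  have e1 : inner ℝ (U (s • x) a) (U (s • y) b) = inner ℝ (U (-(s • y)) a) (U (-(s • x)) b) := by
    rw [hU.inner_map_left, hU.map_comm, ← neg_neg (s • y), ← hU.inner_map_left, neg_neg]
  have e2 : inner ℝ (U (-(s • y)) a) b = inner ℝ a (U (s • y) b) := by
    rw [hU.inner_map_left, neg_neg]
  rw [e1, e2, hU.inner_map_left (s • x) a b]
  simp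
  ring

section Average

/-- The unnormalised average `f ↦ ∫₀^ε U_{s x} f ds` along an orbit. -/
def orbitAverage (hU : IsUnitaryRep U) (x : Plane) (ε : ℝ) : H →L[ℝ] H :=
  LinearMap.mkContinuous
    { toFun := fun f => ∫ s in (0 : ℝ)..ε, U (s • x) f
      map_add' := fun f g => by
        simp only [map_add]
        exact intervalIntegral.integral_add
          (((hU.continuous f).comp (continuous_id.smul continuous_const)).intervalIntegrable _ _)
          (((hU.continuous g).comp (continuous_id.smul continuous_const)).intervalIntegrable _ _)
      map_smul' := fun c f => by
        simp only [map_smul, RingHom.id_apply]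
        exact intervalIntegral.integral_smul c _ }
    |ε| (fun f => by
      have := intervalIntegral.norm_integral_le_of_norm_le_const (a := (0 : ℝ)) (b := ε)
        (f := fun s : ℝ => U (s • x) f) (C := ‖f‖) (fun s _ => (hU.norm_map _ f).le)
      rw [sub_zero] at this
      rw [mul_comm]
      exact this)

variable (hU : IsUnitaryRep U)

theorem orbitAverage_apply (x : Plane) (ε : ℝ) (f : H) :
    orbitAverage hU x ε f = ∫ s in (0 : ℝ)..ε, U (s • x) f := rfl

theorem IsUnitaryRep.continuous_orbit (hU : IsUnitaryRep U) (x : Plane) (f : H) : Continuous fun s : ℝ => U (s • x) f :=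
  (hU.continuous f).comp (continuous_id.smul continuous_const)

variable [CompleteSpace H]

theorem map_orbitAverage (x y : Plane) (ε : ℝ) (f : H) :
    orbitAverage hU x ε (U y f) = U y (orbitAverage hU x ε f) := by
  rw [orbitAverage_apply, orbitAverage_apply, ← ContinuousLinearMap.intervalIntegral_comp_comm _
    ((hU.continuous_orbit x f).intervalIntegrable _ _)]
  simp only [hU.map_comm _ y]

theorem hasDerivAt_orbitAverage (x : Plane) (f : H) (t : ℝ) :
    HasDerivAt (fun ε => orbitAverage hU x ε f) (U (t • x) f) t :=
  ((hU.continuous_orbit x f).integral_hasStrictDerivAt 0 t).hasDerivAt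

theorem isGen_orbitAverage (x : Plane) (ε : ℝ) (f : H) :
    IsGen U x (orbitAverage hU x ε f) (U (ε • x) f - f) := by
  have h1 : HasDerivAt (fun r => orbitAverage hU x (r + ε) f - orbitAverage hU x r f)
      (U (ε • x) f - f) 0 := by
    have e1 := (hasDerivAt_orbitAverage hU x f (0 + ε)).comp_add_const 0 ε
    have e2 := hasDerivAt_orbitAverage hU x f 0
    simpa [hU.map_zero] using e1.fun_sub e2
  refine h1.congr_of_eventuallyEq (Eventually.of_forall fun r => ?_)
  simp only [orbitAverage_apply]
  have hi : ∀ a b : ℝ, IntervalIntegrable (fun s : ℝ => U (s • x) f) volume a b := fun a b =>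
    (hU.continuous_orbit x f).intervalIntegrable _ _
  rw [intervalIntegral.integral_interval_sub_left (hi _ _) (hi _ _),
    ← ContinuousLinearMap.intervalIntegral_comp_comm _ (hi _ _)]
  have := intervalIntegral.integral_comp_add_left (a := (0 : ℝ)) (b := ε)
    (fun s : ℝ => U (s • x) f) r
  rw [add_zero] at this
  rw [← this]
  simp only [add_smul, hU.map_add]

/-- A vector is determined by its averages over short orbit segments. -/
theorem eq_zero_of_orbitAverage (x : Plane) (f : H) (h : ∀ ε, orbitAverage hU x ε f = 0) :
    f = 0 := by
  have h1 := hasDerivAt_orbitAverage hU x f 0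
  simp only [h] at h1
  have := h1.unique (hasDerivAt_const _ _)
  simpa [hU.map_zero] using this

theorem inner_orbitAverage_eq_zero {o : H} (ho : ∀ x, U x o = o) (x : Plane) (ε : ℝ) {f : H}
    (hf : inner ℝ o f = 0) : inner ℝ o (orbitAverage hU x ε f) = 0 := by
  have h := ContinuousLinearMap.intervalIntegral_comp_comm (innerSL ℝ o)
    ((hU.continuous_orbit x f).intervalIntegrable (μ := volume) 0 ε)
  rw [orbitAverage_apply, ← innerSL_apply_apply, ← h]
  have : ∀ s : ℝ, innerSL ℝ o (U (s • x) f) = 0 := fun s => by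
    rw [innerSL_apply_apply, ← hf, ← hU.inner_map_map (s • x) o f, ho]
  simp [this]

end Average

/-- Square integrable vector fields, as pairs of elements of the Hilbert space of scalars. -/
abbrev VecField (H : Type*) [NormedAddCommGroup H] [InnerProductSpace ℝ H] : Type _ :=
  PiLp 2 (fun _ : Fin 2 => H)

theorem inner_vecField (V W : VecField H) :
    inner ℝ V W = inner ℝ (V 0) (W 0) + inner ℝ (V 1) (W 1) := by
  rw [PiLp.inner_apply, Fin.sum_univ_two]

/-- The graph of the gradient `u ↦ (D₁ u, D₂ u)` with domain `H¹`. -/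
def gradGraph (U : Plane → H →L[ℝ] H) : Submodule ℝ (WithLp 2 (H × VecField H)) where
  carrier := {z | ∀ i, IsGen U (basisVec i) z.fst (z.snd i)}
  add_mem' := fun {a b} ha hb i => by
    have := (ha i).add (hb i)
    refine this.congr_of_eventuallyEq (Eventually.of_forall fun t => ?_)
    exact map_add _ _ _
  zero_mem' := fun i => by
    have := hasDerivAt_const (0 : ℝ) (0 : H)
    refine this.congr_of_eventuallyEq (Eventually.of_forall fun t => ?_)
    exact map_zero _
  smul_mem' := fun c a ha i => by
    have := (ha i).const_smul c
    refine this.congr_of_eventuallyEq (Eventually.of_forall fun t => ?_)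
    exact map_smul _ _ _

theorem mem_gradGraph {z : WithLp 2 (H × VecField H)} :
    z ∈ gradGraph U ↔ ∀ i, IsGen U (basisVec i) z.fst (z.snd i) := Iff.rfl

/-- The generators are closed: convergence of `w_n` makes the derivatives of the orbits converge
uniformly in time, as the group is isometric. -/
theorem isClosed_gradGraph (hU : IsUnitaryRep U) :
    IsClosed (gradGraph U : Set (WithLp 2 (H × VecField H))) := by
  refine IsSeqClosed.isClosed fun z w hz hzw i => ?_
  have hf : Tendsto (fun n => (z n).fst) atTop (𝓝 w.fst) :=
    ((WithLp.fstL 2 ℝ H (VecField H)).continuous.tendsto w).comp hzw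
  have hs : Tendsto (fun n => (z n).snd i) atTop (𝓝 (w.snd i)) :=
    (((PiLp.proj (𝕜 := ℝ) 2 (fun _ : Fin 2 => H) i).continuous.comp
      (WithLp.sndL 2 ℝ H (VecField H)).continuous).tendsto w).comp hzw
  have huni : TendstoUniformly (fun n (s : ℝ) => U (s • basisVec i) ((z n).snd i))
      (fun s => U (s • basisVec i) (w.snd i)) atTop := by
    rw [Metric.tendstoUniformly_iff]
    intro ε hε
    filter_upwards [Metric.tendsto_nhds.1 hs ε hε] with n hn s
    rwa [dist_eq_norm, ← map_sub, hU.norm_map, ← dist_eq_norm, dist_comm]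
  have := hasDerivAt_of_tendstoUniformly huni
    (Eventually.of_forall fun n s => hU.hasDerivAt_orbit (hz n i) s)
    (fun s => ((U (s • basisVec i)).continuous.tendsto _).comp hf) 0
  rw [zero_smul, hU.map_zero] at this
  exact this

/-- Potential fields: the closure of the gradients of elements of `H¹`. -/
def potential (U : Plane → H →L[ℝ] H) : Submodule ℝ (VecField H) :=
  ((gradGraph U).map (WithLp.sndL 2 ℝ H (VecField H) : _ →ₗ[ℝ] VecField H)).topologicalClosure

theorem isClosed_potential : IsClosed (potential U : Set (VecField H)) :=
  Submodule.isClosed_topologicalClosure _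

theorem snd_mem_potential {z : WithLp 2 (H × VecField H)} (hz : z ∈ gradGraph U) :
    z.snd ∈ potential U :=
  Submodule.le_topologicalClosure _ (Submodule.mem_map_of_mem hz)

/-- A closed condition that holds for gradients holds for potential fields. -/
theorem potential_induction {p : VecField H → Prop} (hp : IsClosed {V | p V})
    (h : ∀ z ∈ gradGraph U, p z.snd) {V : VecField H} (hV : V ∈ potential U) : p V := by
  refine closure_minimal (t := {V | p V}) ?_ hp hV
  rintro _ ⟨z, hz, rfl⟩
  exact h z hz

theorem exists_mem_gradGraph_dist_lt {V : VecField H} (hV : V ∈ potential U) {ε : ℝ}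
    (hε : 0 < ε) : ∃ z ∈ gradGraph U, ‖V - z.snd‖ < ε := by
  obtain ⟨_, ⟨z, hz, rfl⟩, h⟩ := Metric.mem_closure_iff.1 hV ε hε
  exact ⟨z, hz, by rwa [← dist_eq_norm]⟩

theorem continuous_apply_vecField (i : Fin 2) : Continuous fun V : VecField H => V i :=
  (PiLp.proj (𝕜 := ℝ) 2 (fun _ : Fin 2 => H) i).continuous

/-- Potential fields have mean zero. -/
theorem inner_potential_eq_zero (hU : IsUnitaryRep U) {o : H} (ho : ∀ x, U x o = o)
    {V : VecField H} (hV : V ∈ potential U) (i : Fin 2) : inner ℝ o (V i) = 0 := by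
  refine potential_induction (p := fun V => inner ℝ o (V i) = 0)
    (isClosed_eq (continuous_const.inner (continuous_apply_vecField i)) continuous_const) ?_ hV
  intro z hz
  have h0 : IsGen U (basisVec i) o 0 := by
    unfold IsGen
    simp only [ho]
    exact hasDerivAt_const _ _
  have := h0.inner_skew hU (hz i)
  rw [inner_zero_left] at this
  linarith

/-- Potential fields are curl-free, in the weak sense. -/
theorem potential_curl (hU : IsUnitaryRep U) {V : VecField H} (hV : V ∈ potential U)
    {z : WithLp 2 (H × VecField H)} (hz : z ∈ gradGraph U) :
    inner ℝ (V 0) (z.snd 1) = inner ℝ (V 1) (z.snd 0) := by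
  refine potential_induction (p := fun V => inner ℝ (V 0) (z.snd 1) = inner ℝ (V 1) (z.snd 0))
    (isClosed_eq ((continuous_apply_vecField 0).inner continuous_const)
      ((continuous_apply_vecField 1).inner continuous_const)) ?_ hV
  intro y hy
  exact IsGen.inner_comm hU (hy 0) (hy 1) (hz 0) (hz 1)

variable [CompleteSpace H]

/-- Averaging along both coordinate directions maps into `H¹`. -/
theorem exists_mem_gradGraph_average (hU : IsUnitaryRep U) (ε δ : ℝ) (f : H) :
    ∃ G : VecField H, WithLp.toLp 2
      (orbitAverage hU (basisVec 0) ε (orbitAverage hU (basisVec 1) δ f), G) ∈ gradGraph U := by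
  have h0 := isGen_orbitAverage hU (basisVec 0) ε (orbitAverage hU (basisVec 1) δ f)
  have h1 := (isGen_orbitAverage hU (basisVec 1) δ f).map (orbitAverage hU (basisVec 0) ε)
    (fun y g => map_orbitAverage hU _ y ε g)
  refine ⟨WithLp.toLp 2 ![U (ε • basisVec 0) (orbitAverage hU (basisVec 1) δ f) -
    orbitAverage hU (basisVec 1) δ f, orbitAverage hU (basisVec 0) ε (U (δ • basisVec 1) f - f)],
    fun i => ?_⟩
  fin_cases i
  · exact h0
  · exact h1

/-- `H¹` is dense. -/
theorem eq_zero_of_inner_gradGraph (hU : IsUnitaryRep U) {f : H}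
    (h : ∀ z ∈ gradGraph U, inner ℝ f z.fst = 0) : f = 0 := by
  have h2 : ∀ ε δ v, inner ℝ f (orbitAverage hU (basisVec 0) ε
      (orbitAverage hU (basisVec 1) δ v)) = 0 := fun ε δ v => by
    obtain ⟨G, hG⟩ := exists_mem_gradGraph_average hU ε δ v
    exact h _ hG
  -- Pairings with all averages of `g` determine the pairing with `g`, by differentiation at `ε = 0`.
  have step : ∀ (x : Plane) (g : H), (∀ ε, inner ℝ f (orbitAverage hU x ε g) = 0) →
      inner ℝ f g = 0 := fun x g hg => by
    have h1 := (hasDerivAt_const (0 : ℝ) f).inner ℝ (hasDerivAt_orbitAverage hU x g 0)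
    simp only [hg] at h1
    have := h1.unique (hasDerivAt_const _ _)
    simpa [hU.map_zero] using this
  have h3 : ∀ v, inner ℝ f v = 0 := fun v =>
    step (basisVec 1) v fun δ => step (basisVec 0) _ fun ε => h2 ε δ v
  exact inner_self_eq_zero.1 (h3 f)

/-- The adjoint of an averaging operator preserves `H¹`. -/
theorem adjoint_orbitAverage_mem (hU : IsUnitaryRep U) (x : Plane) (ε : ℝ)
    {z : WithLp 2 (H × VecField H)} (hz : z ∈ gradGraph U) :
    WithLp.toLp 2 ((orbitAverage hU x ε).adjoint z.fst, (WithLp.toLp 2 fun i =>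
      (orbitAverage hU x ε).adjoint (z.snd i) : VecField H)) ∈ gradGraph U := by
  refine fun i => (hz i).map (orbitAverage hU x ε).adjoint fun y g => ?_
  refine ext_inner_right ℝ fun v => ?_
  rw [ContinuousLinearMap.adjoint_inner_left, hU.inner_map_left, hU.inner_map_left,
    ContinuousLinearMap.adjoint_inner_left, map_orbitAverage]

/-- Vector fields that are both divergence-free and curl-free have vanishing mean-zero part.
For fields with components in `H¹` the Cauchy–Riemann equations and the equality of mixed
derivatives give `𝔻W = 0`, so the components are invariant; the general case follows by averaging
along the orbits. -/
theorem eq_zero_of_div_curl (hU : IsUnitaryRep U) {o : H} (ho : ∀ x, U x o = o)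
    (hinv : ∀ f, (∀ x, U x f = f) → ∃ c : ℝ, f = c • o) {W : VecField H}
    (hmean : ∀ i, inner ℝ o (W i) = 0)
    (hdiv : ∀ z ∈ gradGraph U, inner ℝ W z.snd = 0)
    (hcurl : ∀ z ∈ gradGraph U, inner ℝ (W 0) (z.snd 1) = inner ℝ (W 1) (z.snd 0)) : W = 0 := by
  have main : ∀ i ε δ,
      orbitAverage hU (basisVec 0) ε (orbitAverage hU (basisVec 1) δ (W i)) = 0 := by
    intro i ε δ
    set M : H →L[ℝ] H := orbitAverage hU (basisVec 0) ε ∘L orbitAverage hU (basisVec 1) δ with hM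
    have hadj : ∀ z ∈ gradGraph U, ∃ y ∈ gradGraph U, ∀ k, M.adjoint (z.snd k) = y.snd k := by
      intro z hz
      refine ⟨_, adjoint_orbitAverage_mem hU (basisVec 1) δ
        (adjoint_orbitAverage_mem hU (basisVec 0) ε hz), fun k => ?_⟩
      rw [hM, ContinuousLinearMap.adjoint_comp]
      rfl
    have hD : ∀ j, ∃ G : VecField H, ∀ k, IsGen U (basisVec k) (M (W j)) (G k) := fun j =>
      (exists_mem_gradGraph_average hU ε δ (W j)).imp fun G hG => hG
    choose G hG using hD
    -- The averages `M (W j)` inherit both equations, now with strong derivatives `G j k`.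
    have hdivM : G 0 0 + G 1 1 = 0 := eq_zero_of_inner_gradGraph hU fun z hz => by
      obtain ⟨y, hy, hyz⟩ := hadj z hz
      have := hdiv y hy
      rw [inner_vecField, ← hyz, ← hyz, ContinuousLinearMap.adjoint_inner_right,
        ContinuousLinearMap.adjoint_inner_right] at this
      rw [inner_add_left, (hG 0 0).inner_skew hU (hz 0), (hG 1 1).inner_skew hU (hz 1)]
      linarith
    have hcurlM : G 0 1 - G 1 0 = 0 := eq_zero_of_inner_gradGraph hU fun z hz => by
      obtain ⟨y, hy, hyz⟩ := hadj z hz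
      have := hcurl y hy
      rw [← hyz, ← hyz, ContinuousLinearMap.adjoint_inner_right,
        ContinuousLinearMap.adjoint_inner_right] at this
      rw [inner_sub_left, (hG 0 1).inner_skew hU (hz 1), (hG 1 0).inner_skew hU (hz 0)]
      linarith
    have e0 : G 0 0 = -G 1 1 := eq_neg_of_add_eq_zero_left hdivM
    have e1 : G 0 1 = G 1 0 := sub_eq_zero.1 hcurlM
    have hcomm := IsGen.inner_comm hU (hG 0 0) (hG 0 1) (hG 1 0) (hG 1 1)
    -- `‖G 0 0‖² = -⟨G 0 0, G 1 1⟩ = -⟨G 0 1, G 1 0⟩ = -‖G 1 0‖²`.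
    have hsum : ‖G 1 1‖ ^ 2 + ‖G 1 0‖ ^ 2 = 0 := by
      rw [e0, e1, inner_neg_left, real_inner_self_eq_norm_sq, real_inner_self_eq_norm_sq] at hcomm
      linarith
    have z11 : G 1 1 = 0 := norm_eq_zero.1 (pow_eq_zero_iff two_ne_zero |>.1
      (le_antisymm (by nlinarith [sq_nonneg ‖G 1 0‖]) (sq_nonneg _)))
    have z10 : G 1 0 = 0 := norm_eq_zero.1 (pow_eq_zero_iff two_ne_zero |>.1
      (le_antisymm (by nlinarith [sq_nonneg ‖G 1 1‖]) (sq_nonneg _)))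
    have hz : ∀ j k, G j k = 0 := by
      intro j k
      fin_cases j <;> fin_cases k <;> simp [e0, e1, z11, z10]
    have hinvM : ∀ x, U x (M (W i)) = M (W i) := fun x => by
      have hx : x = x 0 • basisVec 0 + x 1 • basisVec 1 := by
        ext k
        fin_cases k <;> simp [basisVec]
      rw [hx, hU.map_add, hU.map_eq_of_isGen_zero (x := basisVec 1) (hz i 1 ▸ hG i 1),
        hU.map_eq_of_isGen_zero (x := basisVec 0) (hz i 0 ▸ hG i 0)]
    obtain ⟨c, hc⟩ := hinv _ hinvM
    have hm : inner ℝ o (M (W i)) = 0 := inner_orbitAverage_eq_zero hU ho _ _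
      (inner_orbitAverage_eq_zero hU ho _ _ (hmean i))
    have h0 : inner ℝ (M (W i)) (M (W i)) = 0 := by
      nth_rewrite 1 [hc]
      rw [inner_smul_left, hm, mul_zero]
    exact inner_self_eq_zero.1 h0
  ext i
  exact eq_zero_of_orbitAverage hU (basisVec 1) _ fun δ =>
    eq_zero_of_orbitAverage hU (basisVec 0) _ fun ε => main i ε δ

/-- In two dimensions, curl-free fields of mean zero are potential. -/
theorem mem_potential_of_curl (hU : IsUnitaryRep U) {o : H} (ho : ∀ x, U x o = o)
    (hinv : ∀ f, (∀ x, U x f = f) → ∃ c : ℝ, f = c • o) {W : VecField H}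
    (hmean : ∀ i, inner ℝ o (W i) = 0)
    (hcurl : ∀ z ∈ gradGraph U, inner ℝ (W 0) (z.snd 1) = inner ℝ (W 1) (z.snd 0)) :
    W ∈ potential U := by
  have : CompleteSpace (potential U) := isClosed_potential.completeSpace_coe
  obtain ⟨p, hp, s, hs, hW⟩ := (potential U).exists_add_mem_mem_orthogonal W
  have hs' : s = W - p := by rw [hW]; abel
  have hs0 : s = 0 := by
    refine eq_zero_of_div_curl hU ho hinv (fun i => ?_)
      (fun z hz => Submodule.inner_left_of_mem_orthogonal (snd_mem_potential hz) hs)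
      (fun z hz => ?_)
    · rw [hs', PiLp.sub_apply, inner_sub_right, hmean, inner_potential_eq_zero hU ho hp, sub_zero]
    · rw [hs', PiLp.sub_apply, PiLp.sub_apply, inner_sub_left, inner_sub_left, hcurl z hz,
        potential_curl hU hp hz]
  rw [hW, hs0, add_zero]
  exact hp

end Group

/-! ### Correctors and the homogenized matrix in a Hilbert space -/

section Homogenization

variable {H : Type*} [NormedAddCommGroup H] [InnerProductSpace ℝ H]

/-- `A` is bounded, symmetric and uniformly elliptic. -/
structure IsElliptic {E : Type*} [NormedAddCommGroup E] [InnerProductSpace ℝ E]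
    (A : E →L[ℝ] E) : Prop where
  symm : ∀ x y, inner ℝ x (A y) = inner ℝ y (A x)
  coercive : ∃ c : ℝ, 0 < c ∧ ∀ x, c * ‖x‖ ^ 2 ≤ inner ℝ x (A x)

namespace IsElliptic

variable {E : Type*} [NormedAddCommGroup E] [InnerProductSpace ℝ E] {A : E →L[ℝ] E}

theorem nonneg (hA : IsElliptic A) (x : E) : 0 ≤ inner ℝ x (A x) := by
  obtain ⟨c, hc, h⟩ := hA.coercive
  exact (by positivity : 0 ≤ c * ‖x‖ ^ 2).trans (h x)

theorem eq_zero (hA : IsElliptic A) {x : E} (hx : inner ℝ x (A x) ≤ 0) : x = 0 := by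
  obtain ⟨c, hc, h⟩ := hA.coercive
  have h1 : c * ‖x‖ ^ 2 ≤ 0 := (h x).trans hx
  have h2 : ‖x‖ ^ 2 ≤ 0 := by nlinarith
  exact norm_eq_zero.1 (pow_eq_zero_iff two_ne_zero |>.1 (le_antisymm h2 (sq_nonneg _)))

theorem inner_add (hA : IsElliptic A) (x y : E) : inner ℝ (x + y) (A (x + y)) =
    inner ℝ x (A x) + 2 * inner ℝ x (A y) + inner ℝ y (A y) := by
  rw [map_add, inner_add_left, inner_add_right, inner_add_right, hA.symm y x]
  ring

theorem inner_sub (hA : IsElliptic A) (x y : E) : inner ℝ (x - y) (A (x - y)) =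
    inner ℝ x (A x) - 2 * inner ℝ x (A y) + inner ℝ y (A y) := by
  rw [map_sub, inner_sub_left, inner_sub_right, inner_sub_right, hA.symm y x]
  ring

theorem inner_sub_le (hA : IsElliptic A) (x y z : E) : inner ℝ (x - z) (A (x - z)) ≤
    2 * inner ℝ (x - y) (A (x - y)) + 2 * inner ℝ (y - z) (A (y - z)) := by
  have h1 := hA.nonneg ((x - y) - (y - z))
  have h2 := hA.inner_sub (x - y) (y - z)
  have h3 := hA.inner_add (x - y) (y - z)
  rw [sub_add_sub_cancel] at h3
  linarith

theorem inner_le (A : E →L[ℝ] E) (x : E) : inner ℝ x (A x) ≤ ‖A‖ * ‖x‖ ^ 2 :=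
  calc inner ℝ x (A x) ≤ ‖x‖ * ‖A x‖ := real_inner_le_norm _ _
    _ ≤ ‖x‖ * (‖A‖ * ‖x‖) := by gcongr; exact A.le_opNorm x
    _ = _ := by ring

end IsElliptic

variable {U : Plane → H →L[ℝ] H} {A : VecField H →L[ℝ] VecField H} {B : H →L[ℝ] H}

/-- The corrector field: the potential field `V` such that `A (b + V)` is divergence-free. -/
theorem exists_potential_corrector [CompleteSpace H] (hA : IsElliptic A) (b : VecField H) :
    ∃ V ∈ potential U, ∀ W ∈ potential U, inner ℝ W (A (b + V)) = 0 := by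
  obtain ⟨c, hc, h⟩ := hA.coercive
  obtain ⟨V, hV, hVW⟩ := exists_mem_forall_inner_eq (potential U) isClosed_potential A hc h (-A b)
  refine ⟨V, hV, fun W hW => ?_⟩
  rw [map_add, _root_.inner_add_right, hVW W hW, inner_neg_right]
  ring

/-- Solvability of the resolvent equation in weak form. -/
theorem exists_resolvent [CompleteSpace H] (hU : IsUnitaryRep U) (hA : IsElliptic A)
    (hB : IsElliptic B) {l : ℝ} (hl : 0 < l) (b : VecField H) :
    ∃ z ∈ gradGraph U, ∀ y ∈ gradGraph U,
      l * inner ℝ y.fst (B z.fst) + inner ℝ y.snd (A (b + z.snd)) = 0 := by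
  obtain ⟨c, hc, h⟩ := hA.coercive
  obtain ⟨d, hd, h'⟩ := hB.coercive
  let T : WithLp 2 (H × VecField H) →L[ℝ] WithLp 2 (H × VecField H) :=
    (WithLp.prodContinuousLinearEquiv 2 ℝ H (VecField H)).symm.toContinuousLinearMap ∘L
      (((l • B) ∘L WithLp.fstL 2 ℝ H (VecField H)).prod (A ∘L WithLp.sndL 2 ℝ H (VecField H)))
  have hT : ∀ x y, inner ℝ x (T y) = l * inner ℝ x.fst (B y.fst) + inner ℝ x.snd (A y.snd) := by
    intro x y
    rw [WithLp.prod_inner_apply, ← inner_smul_right]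
    rfl
  obtain ⟨z, hz, hzy⟩ := exists_mem_forall_inner_eq (gradGraph U) (isClosed_gradGraph hU) T
    (c := min (l * d) c) (lt_min (by positivity) hc) (fun x => by
      rw [hT, WithLp.prod_norm_sq_eq_of_L2, mul_add]
      have h1 : min (l * d) c * ‖x.fst‖ ^ 2 ≤ l * d * ‖x.fst‖ ^ 2 := by
        gcongr; exact min_le_left _ _
      have h2 : min (l * d) c * ‖x.snd‖ ^ 2 ≤ c * ‖x.snd‖ ^ 2 := by
        gcongr; exact min_le_right _ _
      have h3 := mul_le_mul_of_nonneg_left (h' x.fst) hl.le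
      linarith [h x.snd]) (WithLp.toLp 2 (0, -A b))
  refine ⟨z, hz, fun y hy => ?_⟩
  have := hzy y hy
  rw [hT, WithLp.prod_inner_apply] at this
  simp only [inner_zero_right, inner_neg_right] at this
  rw [map_add, _root_.inner_add_right]
  rw [zero_add] at this
  have e : inner ℝ y.snd (A b) = inner ℝ y.ofLp.2 (A b) := rfl
  linarith

/-- The gradients of the solutions of the resolvent equation converge in energy, as `l ↓ 0`, to the
corrector field. -/
theorem tendsto_resolvent (hA : IsElliptic A) (hB : IsElliptic B) {b V : VecField H}
    (hV : V ∈ potential U) (hVW : ∀ W ∈ potential U, inner ℝ W (A (b + V)) = 0)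
    {z : ℝ → WithLp 2 (H × VecField H)} (hz : ∀ l, 0 < l → z l ∈ gradGraph U)
    (hzy : ∀ l, 0 < l → ∀ y ∈ gradGraph U,
      l * inner ℝ y.fst (B (z l).fst) + inner ℝ y.snd (A (b + (z l).snd)) = 0) :
    Tendsto (fun l => inner ℝ ((z l).snd - V) (A ((z l).snd - V))) (𝓝[>] 0) (𝓝 0) := by
  -- Testing with `z l - w` for a fixed `w` in the graph whose gradient is close to `V`.
  have key : ∀ w ∈ gradGraph U, ∀ l, 0 < l → inner ℝ ((z l).snd - V) (A ((z l).snd - V)) ≤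
      4 * inner ℝ (w.snd - V) (A (w.snd - V)) + l * (2 * inner ℝ w.fst (B w.fst)) := by
    intro w hw l hl
    have hy : z l - w ∈ gradGraph U := sub_mem (hz l hl) hw
    have h1 := hzy l hl _ hy
    have h2 := hVW _ (snd_mem_potential hy)
    have e1 : (z l - w).fst = (z l).fst - w.fst := rfl
    have e2 : (z l - w).snd = (z l).snd - w.snd := rfl
    rw [e1, e2] at h1
    rw [e2] at h2
    set d := (z l).snd - w.snd with hd
    set y := (z l).fst - w.fst with hyd
    have h3 : inner ℝ d (A (b + (z l).snd)) =
        inner ℝ d (A (b + V)) + inner ℝ d (A d) + inner ℝ d (A (w.snd - V)) := by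
      rw [← _root_.inner_add_right, ← _root_.inner_add_right, ← map_add, ← map_add, hd]
      congr 2
      abel
    have h4 : inner ℝ y (B (z l).fst) = inner ℝ y (B y) + inner ℝ y (B w.fst) := by
      rw [← _root_.inner_add_right, ← map_add, hyd, sub_add_cancel]
    have h5 := hA.nonneg (d + (w.snd - V))
    rw [hA.inner_add] at h5
    have h6 := hB.nonneg (y + w.fst)
    rw [hB.inner_add] at h6
    have h7 := hA.inner_sub_le (z l).snd w.snd V
    have h8 := hB.nonneg y
    nlinarith [mul_nonneg hl.le h6, mul_nonneg hl.le h8]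
  rw [Metric.tendsto_nhds]
  intro ε hε
  obtain ⟨w, hw, hwV⟩ := exists_mem_gradGraph_dist_lt hV
    (show 0 < Real.sqrt (ε / (8 * (‖A‖ + 1))) by positivity)
  have hsmall : 4 * inner ℝ (w.snd - V) (A (w.snd - V)) ≤ ε / 2 := by
    have h1 := IsElliptic.inner_le A (w.snd - V)
    rw [norm_sub_rev] at hwV
    have h2 : ‖w.snd - V‖ ^ 2 ≤ ε / (8 * (‖A‖ + 1)) := by
      have := pow_le_pow_left₀ (norm_nonneg _) hwV.le 2
      rwa [Real.sq_sqrt (by positivity)] at this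
    have h3 : ‖A‖ * ‖w.snd - V‖ ^ 2 ≤ (‖A‖ + 1) * (ε / (8 * (‖A‖ + 1))) := by
      gcongr
      linarith
    have h4 : (‖A‖ + 1) * (ε / (8 * (‖A‖ + 1))) = ε / 8 := by
      field_simp
    linarith
  have hlim : Tendsto (fun l : ℝ => l * (2 * inner ℝ w.fst (B w.fst))) (𝓝[>] 0) (𝓝 0) := by
    have : Tendsto (fun l : ℝ => l * (2 * inner ℝ w.fst (B w.fst))) (𝓝 0)
        (𝓝 (0 * (2 * inner ℝ w.fst (B w.fst)))) := (continuous_id.mul continuous_const).tendsto 0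
    rw [zero_mul] at this
    exact this.mono_left nhdsWithin_le_nhds
  filter_upwards [Metric.tendsto_nhds.1 hlim (ε / 2) (by positivity), self_mem_nhdsWithin]
    with l hl hl0
  rw [Real.dist_eq, sub_zero] at hl ⊢
  rw [abs_of_nonneg (hA.nonneg _)]
  have := key w hw l hl0
  linarith [le_abs_self (l * (2 * inner ℝ w.fst (B w.fst)))]

/-- The constant vector field `ξ`, where `o` is the constant function one. -/
def constField (o : H) (ξ : Fin 2 → ℝ) : VecField H := WithLp.toLp 2 fun i => ξ i • o

theorem constField_apply (o : H) (ξ : Fin 2 → ℝ) (i : Fin 2) : constField o ξ i = ξ i • o := rfl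

/-- The rotation of a vector field by a right angle. -/
def quarterTurn (W : VecField H) : VecField H := WithLp.toLp 2 ![-W 1, W 0]

theorem quarterTurn_zero (W : VecField H) : quarterTurn W 0 = -W 1 := rfl

theorem quarterTurn_one (W : VecField H) : quarterTurn W 1 = W 0 := rfl

theorem inner_quarterTurn (V W : VecField H) :
    inner ℝ (quarterTurn V) (quarterTurn W) = inner ℝ V W := by
  rw [inner_vecField, inner_vecField, quarterTurn_zero, quarterTurn_one, quarterTurn_zero,
    quarterTurn_one, inner_neg_neg]
  ring

/-- The fields `e_i + V_i` for the corrector fields `V_i` of the coordinate directions. -/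
structure IsCorrected (U : Plane → H →L[ℝ] H) (A : VecField H →L[ℝ] VecField H) (o : H)
    (V : Fin 2 → VecField H) : Prop where
  mem : ∀ i, V i ∈ potential U
  orth : ∀ i, ∀ W ∈ potential U, inner ℝ W (A (constField o (Pi.single i 1) + V i)) = 0

/-- The Keller–Dykhne duality: if `A` has determinant one, i.e. `A J A = J` for the quarter turn
`J`, and the homogenized matrix is `α I`, then `α = 1`. Indeed, the quarter turn of the flux
`A (e₀ + V₀)` is a curl-free field with mean `α e₁`, and its own flux is the quarter turn of
`e₀ + V₀`, hence divergence-free. So it equals `α (e₁ + V₁)`, and a comparison of energies gives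
`α² α = α`. -/
theorem eq_one_of_duality [CompleteSpace H] (hU : IsUnitaryRep U) {o : H} (ho : ∀ x, U x o = o)
    (ho1 : ‖o‖ = 1) (hinv : ∀ f, (∀ x, U x f = f) → ∃ c : ℝ, f = c • o) (hA : IsElliptic A)
    (hAJ : ∀ W, A (quarterTurn (A W)) = quarterTurn W)
    {V : Fin 2 → VecField H} (hV : IsCorrected U A o V) {α : ℝ}
    (hα : ∀ i j, inner ℝ (constField o (Pi.single i 1) + V i)
      (A (constField o (Pi.single j 1) + V j)) = if i = j then α else 0) : α = 1 := by
  have hoo : inner ℝ o o = 1 := by rw [real_inner_self_eq_norm_sq, ho1, one_pow]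
  set X : Fin 2 → VecField H := fun i => constField o (Pi.single i 1) + V i with hX
  have hXo : ∀ i k, inner ℝ o (X i k) = if i = k then 1 else 0 := by
    intro i k
    rw [hX]
    simp only [PiLp.add_apply, constField_apply, _root_.inner_add_right, inner_smul_right, hoo,
      inner_potential_eq_zero hU ho (hV.mem i) k, mul_one, add_zero, Pi.single_apply]
    simp only [eq_comm]
  -- The flux `A (X 0)` has mean `α e₀`.
  have hmean : ∀ k, inner ℝ o (A (X 0) k) = if k = 0 then α else 0 := by
    intro k
    rw [← hα k 0, _root_.inner_add_left, hV.orth 0 _ (hV.mem k), add_zero, inner_vecField]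
    fin_cases k <;> simp [constField_apply, hX]
  set Y : VecField H := quarterTurn (A (X 0)) with hY
  have hWmem : Y - α • constField o (Pi.single 1 1) ∈ potential U := by
    refine mem_potential_of_curl hU ho hinv (fun i => ?_) fun z hz => ?_
    · fin_cases i
      · simp [hY, quarterTurn_zero, constField_apply, hmean]
      · simp [hY, quarterTurn_one, constField_apply, hmean, _root_.inner_sub_right,
          inner_smul_right, ho1]
    · have h1 := hV.orth 0 _ (snd_mem_potential hz)
      rw [real_inner_comm, inner_vecField] at h1
      have h2 := inner_potential_eq_zero hU ho (snd_mem_potential hz) 0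
      simp [hY, quarterTurn_zero, quarterTurn_one, constField_apply, _root_.inner_sub_left,
        inner_smul_left, h2]
      linarith
  have hYX : Y = α • X 1 := by
    have hp : Y - α • X 1 ∈ potential U := by
      have : Y - α • X 1 = (Y - α • constField o (Pi.single 1 1)) - α • V 1 := by
        simp only [hX, smul_add]; abel
      rw [this]
      exact sub_mem hWmem ((potential U).smul_mem α (hV.mem 1))
    refine sub_eq_zero.1 (hA.eq_zero ?_)
    have hq : ∀ W ∈ potential U, inner ℝ W (A Y) = 0 := by
      intro W hW
      refine potential_induction (p := fun W => inner ℝ W (A Y) = 0)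
        (isClosed_eq (continuous_id.inner continuous_const) continuous_const) ?_ hW
      intro z hz
      rw [hY, hAJ, inner_vecField, quarterTurn_zero, quarterTurn_one]
      have h1 := potential_curl hU (hV.mem 0) hz
      have h2 := inner_potential_eq_zero hU ho (snd_mem_potential hz) 1
      simp only [hX, PiLp.add_apply, constField_apply, _root_.inner_add_right, inner_neg_right,
        inner_smul_right]
      rw [real_inner_comm o (z.snd 1), h2, real_inner_comm (V 0 0) (z.snd 1), h1,
        real_inner_comm o (z.snd 0), real_inner_comm (V 0 1) (z.snd 0),
        inner_potential_eq_zero hU ho (snd_mem_potential hz) 0]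
      simp
    rw [map_sub, _root_.inner_sub_right, hq _ hp, map_smul, inner_smul_right, hV.orth 1 _ hp]
    simp
  have e1 : inner ℝ Y (A Y) = α := by
    have h := hα 0 0
    rw [if_pos rfl] at h
    rw [← h, hY, hAJ, inner_quarterTurn, real_inner_comm]
  have e2 : inner ℝ Y (A Y) = α * (α * α) := by
    have h := hα 1 1
    rw [if_pos rfl] at h
    rw [hYX, map_smul, inner_smul_left, inner_smul_right, h]
    simp
  have hpos : 0 < α := by
    by_contra! hle
    have h := hα 0 0
    rw [if_pos rfl] at h
    have h0 : X 0 = 0 := hA.eq_zero (h.le.trans hle)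
    have := hXo 0 0
    rw [h0] at this
    simp at this
  have h3 : α * ((α - 1) * (α + 1)) = 0 := by rw [e1] at e2; linarith
  rcases mul_eq_zero.1 h3 with h | h
  · exact absurd h hpos.ne'
  · rcases mul_eq_zero.1 h with h | h <;> linarith

/-- A symmetric `2 × 2` quadratic form that does not increase under a rotation by an angle other
than `0` and `π` is isotropic: its trace is preserved, so that it is in fact invariant. -/
theorem isotropic_of_rotation_le {a b d c s : ℝ} (hs : s ≠ 0) (hcs : c ^ 2 + s ^ 2 = 1)
    (h : ∀ x y : ℝ, a * (c * x + s * y) ^ 2 + 2 * b * ((c * x + s * y) * (-s * x + c * y)) +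
      d * (-s * x + c * y) ^ 2 ≤ a * x ^ 2 + 2 * b * (x * y) + d * y ^ 2) : a = d ∧ b = 0 := by
  -- The inequalities at the four vectors below add up to equalities in pairs.
  have h1 := h 1 0
  have h2 := h 0 1
  have h3 := h 1 1
  have h4 := h 1 (-1)
  have hc : c ^ 2 = 1 - s ^ 2 := by linarith
  have ha : a * c ^ 2 = a * (1 - s ^ 2) := by rw [hc]
  have hb : b * c ^ 2 = b * (1 - s ^ 2) := by rw [hc]
  have hd : d * c ^ 2 = d * (1 - s ^ 2) := by rw [hc]
  have e1 : s * (s * (d - a) - 2 * b * c) = 0 := by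
    apply le_antisymm <;> nlinarith
  have e2 : s * (c * (a - d) - 2 * b * s) = 0 := by
    apply le_antisymm <;> nlinarith
  have e1' := (mul_eq_zero.1 e1).resolve_left hs
  have e2' := (mul_eq_zero.1 e2).resolve_left hs
  have e3 : a = d := by
    have : (a - d) * (c ^ 2 + s ^ 2) = 0 := by linear_combination c * e2' - s * e1'
    rw [hcs, mul_one] at this
    linarith
  refine ⟨e3, ?_⟩
  subst e3
  have : b * s = 0 := by linarith
  exact (mul_eq_zero.1 this).resolve_right hs

/-- A map `T` of vector fields that preserves potential fields and the energy, and acts on constant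
fields by the inverse of a rotation, forces the homogenized matrix to be isotropic. -/
theorem isotropic_of_symmetry {o : H} (hA : IsElliptic A) {V : Fin 2 → VecField H}
    (hV : IsCorrected U A o V) (T : VecField H →L[ℝ] VecField H)
    (hTpot : ∀ z ∈ gradGraph U, T z.snd ∈ potential U)
    (hTA : ∀ X, inner ℝ (T X) (A (T X)) = inner ℝ X (A X)) {c s : ℝ} (hs : s ≠ 0)
    (hcs : c ^ 2 + s ^ 2 = 1)
    (hTo : ∀ ξ : Fin 2 → ℝ,
      T (constField o ξ) = constField o ![c * ξ 0 + s * ξ 1, -s * ξ 0 + c * ξ 1]) (i j : Fin 2) :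
    inner ℝ (constField o (Pi.single i 1) + V i) (A (constField o (Pi.single j 1) + V j)) =
      if i = j then inner ℝ (constField o (Pi.single 0 1) + V 0)
        (A (constField o (Pi.single 0 1) + V 0)) else 0 := by
  set X : Fin 2 → VecField H := fun i => constField o (Pi.single i 1) + V i with hX
  have hXx : ∀ x y : ℝ, x • X 0 + y • X 1 = constField o ![x, y] + (x • V 0 + y • V 1) := by
    intro x y
    ext k
    fin_cases k <;> simp [hX, constField_apply] <;> abel
  have hq : ∀ x y : ℝ, inner ℝ (x • X 0 + y • X 1) (A (x • X 0 + y • X 1)) =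
      inner ℝ (X 0) (A (X 0)) * x ^ 2 + 2 * inner ℝ (X 0) (A (X 1)) * (x * y) +
        inner ℝ (X 1) (A (X 1)) * y ^ 2 := by
    intro x y
    rw [hA.inner_add]
    simp only [map_smul, inner_smul_left, inner_smul_right, conj_trivial]
    ring
  have hVc : ∀ x y : ℝ, x • V 0 + y • V 1 ∈ potential U := fun x y =>
    add_mem ((potential U).smul_mem _ (hV.mem 0)) ((potential U).smul_mem _ (hV.mem 1))
  have hTV : ∀ W ∈ potential U, T W ∈ potential U := fun W hW =>
    potential_induction (p := fun W => T W ∈ potential U)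
      (isClosed_potential.preimage T.continuous) hTpot hW
  -- `x • X 0 + y • X 1` minimises the energy among the potential perturbations of its mean.
  have hmin : ∀ x y : ℝ, ∀ W ∈ potential U,
      inner ℝ (x • X 0 + y • X 1) (A (x • X 0 + y • X 1)) ≤
        inner ℝ (constField o ![x, y] + W) (A (constField o ![x, y] + W)) := by
    intro x y W hW
    have hW' : W - (x • V 0 + y • V 1) ∈ potential U := sub_mem hW (hVc x y)
    have e : constField o ![x, y] + W =
        (W - (x • V 0 + y • V 1)) + (x • X 0 + y • X 1) := by
      rw [hXx]; abel
    have e0 : inner ℝ (W - (x • V 0 + y • V 1)) (A (x • X 0 + y • X 1)) = 0 := by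
      rw [map_add, _root_.inner_add_right, map_smul, map_smul, inner_smul_right,
        inner_smul_right, hV.orth 0 _ hW', hV.orth 1 _ hW']
      ring
    rw [e, hA.inner_add (W - (x • V 0 + y • V 1)), e0]
    linarith [hA.nonneg (W - (x • V 0 + y • V 1))]
  have hrot := isotropic_of_rotation_le (a := inner ℝ (X 0) (A (X 0)))
    (b := inner ℝ (X 0) (A (X 1))) (d := inner ℝ (X 1) (A (X 1))) hs hcs fun x y => by
      rw [← hq, ← hq, ← hTA (x • X 0 + y • X 1), hXx x y, map_add T, hTo]
      exact hmin _ _ _ (hTV _ (hVc x y))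
  fin_cases i <;> fin_cases j
  · simp
  · exact hrot.2
  · exact (hA.symm _ _).trans hrot.2
  · exact hrot.1.symm

end Homogenization

/-! ### Translations of `C³` functions -/

section FieldSpace

theorem isInducing_jet : IsInducing Field.jet := ⟨rfl⟩

instance : TopologicalSpace.PseudoMetrizableSpace Field := isInducing_jet.pseudoMetrizableSpace

theorem jet_translate (x : Plane) (h : Field) (k : Fin 4) (y : Plane) :
    (translate x h).jet k y = h.jet k (y + x) :=
  iteratedFDeriv_comp_add_right (f := h) (k : ℕ) x y

/-- Translations act jointly continuously on `C³` functions. -/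
theorem continuous_translate_uncurry :
    Continuous fun p : Plane × Field => translate p.1 p.2 := by
  refine isInducing_jet.continuous_iff.2 (continuous_pi fun k => ?_)
  refine ContinuousMap.continuous_of_continuous_uncurry _ ?_
  have h1 : Continuous fun q : (Plane × Field) × Plane => q.1.2.jet k :=
    (continuous_apply k).comp (isInducing_jet.continuous.comp
      (continuous_snd.comp continuous_fst))
  have h2 : Continuous fun q : (Plane × Field) × Plane => q.2 + q.1.1 := by fun_prop
  refine (h1.eval h2).congr fun q => ?_
  exact (jet_translate q.1.1 q.1.2 k q.2).symm

theorem continuous_translate (x : Plane) : Continuous (translate x) :=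
  continuous_translate_uncurry.comp (Continuous.prodMk_right x)

theorem continuous_translate_left (h : Field) : Continuous fun x => translate x h :=
  continuous_translate_uncurry.comp (Continuous.prodMk_left h)

theorem translate_zero (h : Field) : translate 0 h = h := by
  apply Subtype.ext
  funext y
  simp [translate]

theorem translate_translate (x y : Plane) (h : Field) :
    translate x (translate y h) = translate (x + y) h := by
  apply Subtype.ext
  funext z
  simp [translate, add_assoc]

end FieldSpace

/-! ### The unitary group of translations and ergodicity -/

section Shift

variable {P : Measure Field}

theorem IsAdmissible.measurePreserving (hP : IsAdmissible P) (x : Plane) :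
    MeasurePreserving (translate x) P P :=
  ⟨(continuous_translate x).measurable, Measure.ext fun B hB => by
    rw [Measure.map_apply (continuous_translate x).measurable hB, hP.stationary x B hB]⟩

/-- Dominated convergence in `L²` for uniformly bounded functions. -/
theorem tendsto_eLpNorm_two_of_bounded {Ω ι : Type*} [MeasurableSpace Ω] {μ : Measure Ω}
    [IsFiniteMeasure μ] {l : Filter ι} [l.IsCountablyGenerated] {F : ι → Ω → ℝ} {C : ℝ}
    (hF : ∀ᶠ n in l, Measurable (F n)) (hb : ∀ᶠ n in l, ∀ᵐ ω ∂μ, |F n ω| ≤ C)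
    (hlim : ∀ᵐ ω ∂μ, Tendsto (fun n => F n ω) l (𝓝 0)) :
    Tendsto (fun n => eLpNorm (F n) 2 μ) l (𝓝 0) := by
  have h1 : Tendsto (fun n => ∫⁻ ω, ‖F n ω‖ₑ ^ (2 : ℝ) ∂μ) l (𝓝 (∫⁻ _, 0 ∂μ)) := by
    refine tendsto_lintegral_filter_of_dominated_convergence
      (fun _ => ENNReal.ofReal C ^ (2 : ℝ)) ?_ ?_ ?_ ?_
    · filter_upwards [hF] with n hn
      exact hn.enorm.pow_const 2
    · filter_upwards [hb] with n hn
      filter_upwards [hn] with ω hω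
      gcongr
      rw [Real.enorm_eq_ofReal_abs]
      exact ENNReal.ofReal_le_ofReal hω
    · rw [lintegral_const]
      exact ENNReal.mul_ne_top (ENNReal.rpow_ne_top_of_nonneg (by norm_num) ENNReal.ofReal_ne_top)
        (measure_ne_top _ _)
    · filter_upwards [hlim] with ω hω
      have h2 : Tendsto (fun n => ‖F n ω‖ₑ) l (𝓝 0) := by
        have := (continuous_enorm.tendsto (0 : ℝ)).comp hω
        rwa [enorm_zero] at this
      have h3 := ((ENNReal.continuous_rpow_const (y := 2)).tendsto 0).comp h2
      rwa [ENNReal.zero_rpow_of_pos (by norm_num)] at h3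
  rw [lintegral_zero] at h1
  have h4 := ((ENNReal.continuous_rpow_const (y := 1 / 2)).tendsto 0).comp h1
  rw [ENNReal.zero_rpow_of_pos (by norm_num)] at h4
  refine h4.congr fun n => ?_
  rw [eLpNorm_eq_lintegral_rpow_enorm_toReal (by norm_num) (by norm_num)]
  simp

/-- The unitary group `f ↦ f ∘ τ_x` on `L²(P)`. -/
def shift (hP : IsAdmissible P) (x : Plane) : Lp ℝ 2 P →L[ℝ] Lp ℝ 2 P :=
  (Lp.compMeasurePreservingₗᵢ ℝ (translate x) (hP.measurePreserving x)).toContinuousLinearMap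

variable (hP : IsAdmissible P)

theorem shift_toLp (x : Plane) {f : Field → ℝ} (hf : MemLp f 2 P) :
    shift hP x (hf.toLp f) =
      (hf.comp_measurePreserving (hP.measurePreserving x)).toLp (fun h => f (translate x h)) :=
  rfl

theorem coeFn_shift (x : Plane) (f : Lp ℝ 2 P) :
    shift hP x f =ᵐ[P] fun h => f (translate x h) :=
  Lp.coeFn_compMeasurePreserving f (hP.measurePreserving x)

/-- Strong continuity. It suffices to consider bounded continuous functions, which are dense in
`L²(P)` as `C³` is metrizable, and for which it follows from the continuity of `x ↦ τ_x h` by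
dominated convergence. -/
theorem continuous_shift (f : Lp ℝ 2 P) : Continuous fun x => shift hP x f := by
  have := hP.prob
  have key : Continuous fun p : Lp ℝ 2 P × Plane => shift hP p.2 p.1 := by
    refine continuous_prod_of_dense_continuous_lipschitzWith _ 1
      (BoundedContinuousFunction.toLp_denseRange ℝ P ℝ (p := 2) (by norm_num)) ?_
      (fun x => (Lp.isometry_compMeasurePreserving (hP.measurePreserving x)).lipschitz)
    rintro _ ⟨f, rfl⟩
    rw [continuous_iff_continuousAt]
    intro x₀
    have hf : MemLp f 2 P := MemLp.of_bound f.continuous.measurable.aestronglyMeasurable ‖f‖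
      (Eventually.of_forall f.norm_coe_le_norm)
    have hfe : BoundedContinuousFunction.toLp 2 P ℝ f = hf.toLp f :=
      Lp.ext ((BoundedContinuousFunction.coeFn_toLp 2 P ℝ f).trans hf.coeFn_toLp.symm)
    rw [ContinuousAt, hfe]
    simp only [shift_toLp]
    rw [Lp.tendsto_Lp_iff_tendsto_eLpNorm'']
    refine tendsto_eLpNorm_two_of_bounded (C := ‖f‖ + ‖f‖)
      (Eventually.of_forall fun x => ?_)
      (Eventually.of_forall fun x => Eventually.of_forall fun h => ?_)
      (Eventually.of_forall fun h => ?_)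
    · exact ((f.continuous.comp (continuous_translate x)).sub
        (f.continuous.comp (continuous_translate x₀))).measurable
    · exact (abs_sub _ _).trans (add_le_add (f.norm_coe_le_norm _) (f.norm_coe_le_norm _))
    · have := ((f.continuous.comp (continuous_translate_left h)).tendsto x₀).sub_const
        (f (translate x₀ h))
      rw [Function.comp_apply, sub_self] at this
      exact this
  have hpair : Continuous fun x : Plane => (f, x) := continuous_const.prodMk continuous_id
  have h1 := key.comp hpair
  have h2 : ((fun p : Lp ℝ 2 P × Plane => shift hP p.2 p.1) ∘ fun x : Plane => (f, x)) =
    fun x => shift hP x f := rfl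
  rw [h2] at h1
  exact h1

theorem isUnitaryRep_shift : IsUnitaryRep (shift hP) where
  map_zero f := by
    refine Lp.ext ?_
    filter_upwards [coeFn_shift hP 0 f] with h hh
    rw [hh, translate_zero]
  map_add x y f := by
    refine Lp.ext ?_
    filter_upwards [coeFn_shift hP (x + y) f, coeFn_shift hP x (shift hP y f),
      (hP.measurePreserving x).quasiMeasurePreserving.ae (coeFn_shift hP y f)] with h h1 h2 h3
    rw [h1, h2, h3, translate_translate, add_comm]
  norm_map x f := Lp.norm_compMeasurePreserving f (hP.measurePreserving x)
  continuous := continuous_shift hP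

/-- A measurable function that is invariant under each translation up to a null set is almost surely
constant. The level sets are replaced by the strictly invariant events
`{h | f (τ_x h) ∈ S for almost every x}`, to which ergodicity applies. -/
theorem ae_const_of_translate_ae_eq (hP : IsAdmissible P) {f : Field → ℝ} (hf : Measurable f)
    (hinv : ∀ x, (fun h => f (translate x h)) =ᵐ[P] f) : ∃ c : ℝ, f =ᵐ[P] fun _ => c := by
  have := hP.prob
  have hjoint : Measurable fun p : Plane × Field => f (translate p.1 p.2) :=
    hf.comp continuous_translate_uncurry.measurable
  -- Almost every `h` satisfies `f (τ_x h) = f h` for almost every `x`.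
  have hae : ∀ᵐ h ∂P, ∀ᵐ x ∂(volume : Measure Plane), f (translate x h) = f h := by
    have h1 : MeasurableSet {p : Plane × Field | f (translate p.1 p.2) = f p.2} :=
      measurableSet_eq_fun hjoint (hf.comp measurable_snd)
    have h2 : ∀ᵐ p ∂((volume : Measure Plane).prod P), f (translate p.1 p.2) = f p.2 :=
      (Measure.ae_prod_iff_ae_ae h1).2 (Eventually.of_forall fun x => hinv x)
    have h3 := Measure.measurePreserving_swap (μ := P) (ν := (volume : Measure Plane))
    exact Measure.ae_ae_of_ae_prod (h3.quasiMeasurePreserving.ae h2)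
  refine exists_eventuallyEq_const_of_forall_separating (l := ae P) MeasurableSet fun S hS => ?_
  set B : Set Field := {h | ∀ᵐ x ∂(volume : Measure Plane), f (translate x h) ∈ S} with hB
  have hBm : MeasurableSet B := by
    have h1 : MeasurableSet {p : Field × Plane | f (translate p.2 p.1) ∈ Sᶜ} :=
      (hjoint.comp measurable_swap) hS.compl
    have h2 := measurable_measure_prodMk_left (ν := (volume : Measure Plane)) h1
    exact h2 (measurableSet_singleton 0)
  have hBt : ∀ y h, h ∈ B → translate y h ∈ B := by
    intro y h hh
    have := (measurePreserving_add_right (volume : Measure Plane) y).quasiMeasurePreserving.ae hh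
    filter_upwards [this] with x hx
    rwa [translate_translate]
  have hBinv : ∀ y, translate y '' B = B := by
    intro y
    refine Set.Subset.antisymm ?_ fun h hh => ⟨translate (-y) h, hBt _ _ hh, ?_⟩
    · rintro _ ⟨h, hh, rfl⟩
      exact hBt y h hh
    · rw [translate_translate, add_neg_cancel, translate_zero]
  have hfB : ∀ᵐ h ∂P, f h ∈ S ↔ h ∈ B := by
    filter_upwards [hae] with h hh
    constructor
    · intro hS'
      filter_upwards [hh] with x hx
      rwa [hx]
    · intro hB'
      obtain ⟨x, hx1, hx2⟩ := (hh.and hB').exists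
      rwa [← hx1]
  rcases hP.ergodic B hBm hBinv with h0 | h1
  · right
    filter_upwards [hfB, measure_eq_zero_iff_ae_notMem.1 h0] with h h2 h3
    rwa [h2]
  · left
    filter_upwards [hfB, (prob_compl_eq_zero_iff hBm).2 h1 |> measure_eq_zero_iff_ae_notMem.1]
      with h h2 h3
    rw [h2]
    simpa using h3

variable (P) in
/-- The constant function one in `L²(P)`. -/
def oneLp [IsFiniteMeasure P] : Lp ℝ 2 P := (memLp_const (1 : ℝ)).toLp _

theorem shift_oneLp [IsFiniteMeasure P] (x : Plane) : shift hP x (oneLp P) = oneLp P :=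
  shift_toLp hP x (memLp_const 1)

theorem norm_oneLp [IsProbabilityMeasure P] : ‖oneLp P‖ = 1 := by
  rw [oneLp, Lp.norm_toLp, eLpNorm_const _ (by norm_num) (NeZero.ne _)]
  simp

/-- Invariant elements of `L²(P)` are constant. -/
theorem exists_eq_smul_oneLp [IsFiniteMeasure P] (f : Lp ℝ 2 P) (hf : ∀ x, shift hP x f = f) :
    ∃ c : ℝ, f = c • oneLp P := by
  obtain ⟨c, hc⟩ := ae_const_of_translate_ae_eq hP (Lp.stronglyMeasurable f).measurable
    fun x => by
      have h1 := coeFn_shift hP x f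
      rw [hf x] at h1
      exact h1.symm
  refine ⟨c, Lp.ext ?_⟩
  filter_upwards [hc, Lp.coeFn_smul c (oneLp P), (memLp_const (1 : ℝ)).coeFn_toLp (μ := P) (p := 2)]
    with h h1 h2 h3
  rw [h1, h2, Pi.smul_apply, oneLp, h3, smul_eq_mul, mul_one]

end Shift

/-! ### Multiplication operators on `L²` -/

section Multiplication

variable {Ω : Type*} [MeasurableSpace Ω] {μ : Measure Ω}

/-- Multiplication by an essentially bounded function on `L²`. -/
def mulLp {m : Ω → ℝ} (hm : MemLp m ⊤ μ) : Lp ℝ 2 μ →L[ℝ] Lp ℝ 2 μ :=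
  (ContinuousLinearMap.mul ℝ ℝ).holderL μ ⊤ 2 2 (hm.toLp m)

theorem coeFn_mulLp {m : Ω → ℝ} (hm : MemLp m ⊤ μ) (f : Lp ℝ 2 μ) :
    mulLp hm f =ᵐ[μ] fun ω => m ω * f ω := by
  filter_upwards [(ContinuousLinearMap.mul ℝ ℝ).coeFn_holder (r := 2) (hm.toLp m) f,
    hm.coeFn_toLp] with ω h1 h2
  rw [← h2]
  exact h1

theorem inner_mulLp {m : Ω → ℝ} (hm : MemLp m ⊤ μ) (f g : Lp ℝ 2 μ) :
    inner ℝ f (mulLp hm g) = ∫ ω, f ω * (m ω * g ω) ∂μ := by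
  rw [L2.inner_def]
  refine integral_congr_ae ?_
  filter_upwards [coeFn_mulLp hm g] with ω h
  rw [h, real_inner_comm]
  rfl

theorem integrable_mul_mulLp {m : Ω → ℝ} (hm : MemLp m ⊤ μ) (f g : Lp ℝ 2 μ) :
    Integrable (fun ω => f ω * (m ω * g ω)) μ := by
  refine (L2.integrable_inner (𝕜 := ℝ) f (mulLp hm g)).congr ?_
  filter_upwards [coeFn_mulLp hm g] with ω h
  rw [h, real_inner_comm]
  rfl

theorem integrable_sq_Lp (f : Lp ℝ 2 μ) : Integrable (fun ω => f ω ^ 2) μ :=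
  (Lp.memLp f).integrable_sq

theorem norm_sq_Lp (f : Lp ℝ 2 μ) : ‖f‖ ^ 2 = ∫ ω, f ω ^ 2 ∂μ := by
  rw [← real_inner_self_eq_norm_sq, L2.inner_def]
  refine integral_congr_ae (Eventually.of_forall fun ω => ?_)
  change f ω * f ω = _
  ring

theorem isElliptic_mulLp {m : Ω → ℝ} (hm : MemLp m ⊤ μ) {c : ℝ} (hc : 0 < c)
    (hcm : ∀ᵐ ω ∂μ, c ≤ m ω) : IsElliptic (mulLp hm) where
  symm f g := by
    rw [inner_mulLp, inner_mulLp]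
    congr 1
    funext ω
    ring
  coercive := by
    refine ⟨c, hc, fun f => ?_⟩
    rw [inner_mulLp, norm_sq_Lp, ← integral_const_mul]
    refine integral_mono_ae ((integrable_sq_Lp f).const_mul c) (integrable_mul_mulLp hm f f) ?_
    filter_upwards [hcm] with ω h
    have := mul_le_mul_of_nonneg_right h (sq_nonneg (f ω))
    change c * f ω ^ 2 ≤ f ω * (m ω * f ω)
    linarith

/-- Multiplication of a vector field by a matrix of essentially bounded functions. -/
def matLp {a : Fin 2 → Fin 2 → Ω → ℝ} (ha : ∀ i j, MemLp (a i j) ⊤ μ) :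
    VecField (Lp ℝ 2 μ) →L[ℝ] VecField (Lp ℝ 2 μ) :=
  (PiLp.continuousLinearEquiv 2 ℝ (fun _ : Fin 2 => Lp ℝ 2 μ)).symm.toContinuousLinearMap ∘L
    ContinuousLinearMap.pi fun i =>
      mulLp (ha i 0) ∘L PiLp.proj 2 (fun _ : Fin 2 => Lp ℝ 2 μ) 0 +
        mulLp (ha i 1) ∘L PiLp.proj 2 (fun _ : Fin 2 => Lp ℝ 2 μ) 1

theorem matLp_apply {a : Fin 2 → Fin 2 → Ω → ℝ} (ha : ∀ i j, MemLp (a i j) ⊤ μ)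
    (V : VecField (Lp ℝ 2 μ)) (i : Fin 2) :
    matLp ha V i = mulLp (ha i 0) (V 0) + mulLp (ha i 1) (V 1) := rfl

theorem coeFn_matLp {a : Fin 2 → Fin 2 → Ω → ℝ} (ha : ∀ i j, MemLp (a i j) ⊤ μ)
    (V : VecField (Lp ℝ 2 μ)) (i : Fin 2) :
    matLp ha V i =ᵐ[μ] fun ω => a i 0 ω * V 0 ω + a i 1 ω * V 1 ω := by
  filter_upwards [Lp.coeFn_add (mulLp (ha i 0) (V 0)) (mulLp (ha i 1) (V 1)),
    coeFn_mulLp (ha i 0) (V 0), coeFn_mulLp (ha i 1) (V 1)] with ω h1 h2 h3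
  rw [matLp_apply, h1, Pi.add_apply, h2, h3]

theorem integrable_matLp {a : Fin 2 → Fin 2 → Ω → ℝ} (ha : ∀ i j, MemLp (a i j) ⊤ μ)
    (V W : VecField (Lp ℝ 2 μ)) :
    Integrable (fun ω => ∑ i, ∑ j, V i ω * (a i j ω * W j ω)) μ :=
  integrable_finsetSum _ fun i _ => integrable_finsetSum _ fun j _ =>
    integrable_mul_mulLp (ha i j) (V i) (W j)

theorem inner_matLp {a : Fin 2 → Fin 2 → Ω → ℝ} (ha : ∀ i j, MemLp (a i j) ⊤ μ)
    (V W : VecField (Lp ℝ 2 μ)) :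
    inner ℝ V (matLp ha W) = ∫ ω, ∑ i, ∑ j, V i ω * (a i j ω * W j ω) ∂μ := by
  rw [integral_finsetSum _ fun i _ => integrable_finsetSum _ fun j _ =>
    integrable_mul_mulLp (ha i j) (V i) (W j), PiLp.inner_apply]
  refine Finset.sum_congr rfl fun i _ => ?_
  rw [integral_finsetSum _ fun j _ => integrable_mul_mulLp (ha i j) (V i) (W j), matLp_apply,
    inner_add_right, inner_mulLp, inner_mulLp, Fin.sum_univ_two]

theorem isElliptic_matLp {a : Fin 2 → Fin 2 → Ω → ℝ} (ha : ∀ i j, MemLp (a i j) ⊤ μ)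
    (hsymm : ∀ ω i j, a i j ω = a j i ω) {c : ℝ} (hc : 0 < c)
    (hca : ∀ᵐ ω ∂μ, ∀ x : Fin 2 → ℝ, c * ∑ i, x i ^ 2 ≤ ∑ i, ∑ j, x i * (a i j ω * x j)) :
    IsElliptic (matLp ha) where
  symm V W := by
    rw [inner_matLp, inner_matLp]
    congr 1
    funext ω
    rw [Finset.sum_comm]
    refine Finset.sum_congr rfl fun i _ => Finset.sum_congr rfl fun j _ => ?_
    rw [hsymm ω i j]
    ring
  coercive := by
    refine ⟨c, hc, fun V => ?_⟩
    have h1 : ‖V‖ ^ 2 = ∫ ω, ∑ i, V i ω ^ 2 ∂μ := by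
      rw [PiLp.norm_sq_eq_of_L2, integral_finsetSum _ fun i _ => integrable_sq_Lp (V i)]
      exact Finset.sum_congr rfl fun i _ => norm_sq_Lp (V i)
    rw [inner_matLp, h1, ← integral_const_mul]
    refine integral_mono_ae
      ((integrable_finsetSum _ fun i _ => integrable_sq_Lp (V i)).const_mul c)
      (integrable_matLp ha V V) ?_
    filter_upwards [hca] with ω h
    exact h fun i => V i ω

/-- Symmetric matrices `a` of determinant one satisfy `a J a = J`. -/
theorem matLp_quarterTurn {a : Fin 2 → Fin 2 → Ω → ℝ} (ha : ∀ i j, MemLp (a i j) ⊤ μ)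
    (hsymm : ∀ ω i j, a i j ω = a j i ω)
    (hdet : ∀ ω, a 0 0 ω * a 1 1 ω - a 0 1 ω ^ 2 = 1) (W : VecField (Lp ℝ 2 μ)) :
    matLp ha (quarterTurn (matLp ha W)) = quarterTurn W := by
  have key : ∀ i, matLp ha (quarterTurn (matLp ha W)) i =ᵐ[μ] fun ω =>
      a i 0 ω * -(a 1 0 ω * W 0 ω + a 1 1 ω * W 1 ω) +
        a i 1 ω * (a 0 0 ω * W 0 ω + a 0 1 ω * W 1 ω) := by
    intro i
    filter_upwards [coeFn_matLp ha (quarterTurn (matLp ha W)) i, coeFn_matLp ha W 0,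
      coeFn_matLp ha W 1, Lp.coeFn_neg (matLp ha W 1)] with ω h1 h2 h3 h4
    rw [h1, quarterTurn_zero, quarterTurn_one, h4, Pi.neg_apply, h2, h3]
  ext1 i
  refine Lp.ext ?_
  fin_cases i
  · filter_upwards [key 0, Lp.coeFn_neg (W 1)] with ω h1 h2
    have h3 := hdet ω
    have h4 := hsymm ω 1 0
    change matLp ha (quarterTurn (matLp ha W)) 0 ω = (-W 1 : Lp ℝ 2 μ) ω
    rw [h1, h2, Pi.neg_apply, h4]
    linear_combination (-W 1 ω) * h3
  · filter_upwards [key 1] with ω h1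
    have h3 := hdet ω
    have h4 := hsymm ω 1 0
    change matLp ha (quarterTurn (matLp ha W)) 1 ω = W 0 ω
    rw [h1, h4]
    linear_combination (W 0 ω) * h3

end Multiplication

/-! ### The matrix `√|g| g⁻¹` as a function of the slope -/

section Coefficients

/-- The entries of `√|g| g⁻¹` for `g = I + p ⊗ p`. -/
def surfaceCoeff (i j : Fin 2) (p : Plane) : ℝ :=
  √(1 + Matrix.vecMulVec p.ofLp p.ofLp : Matrix (Fin 2) (Fin 2) ℝ).det *
    (1 + Matrix.vecMulVec p.ofLp p.ofLp : Matrix (Fin 2) (Fin 2) ℝ)⁻¹ i j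

theorem areaElement_mul_inv (h : Field) (x : Plane) (i j : Fin 2) :
    areaElement h x * (metric h x)⁻¹ i j = surfaceCoeff i j (gradient h x) := rfl

/-- The factor `√|g|` for `g = I + p ⊗ p`. -/
def areaFactor (p : Plane) : ℝ := √(1 + p 0 ^ 2 + p 1 ^ 2)

theorem det_metric (p : Plane) :
    (1 + Matrix.vecMulVec p.ofLp p.ofLp : Matrix (Fin 2) (Fin 2) ℝ).det =
      1 + p 0 ^ 2 + p 1 ^ 2 := by
  rw [Matrix.det_fin_two]
  simp [Matrix.vecMulVec_apply]
  ring

theorem areaElement_eq (h : Field) (x : Plane) : areaElement h x = areaFactor (gradient h x) := by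
  rw [areaElement, metric, det_metric, areaFactor]

theorem areaFactor_sq (p : Plane) : areaFactor p ^ 2 = 1 + p 0 ^ 2 + p 1 ^ 2 :=
  Real.sq_sqrt (by positivity)

theorem one_le_areaFactor (p : Plane) : 1 ≤ areaFactor p :=
  Real.one_le_sqrt.2 (by nlinarith [sq_nonneg (p 0), sq_nonneg (p 1)])

theorem norm_sq_plane (p : Plane) : ‖p‖ ^ 2 = p 0 ^ 2 + p 1 ^ 2 := by
  rw [EuclideanSpace.norm_sq_eq, Fin.sum_univ_two]
  simp

theorem areaFactor_le (p : Plane) : areaFactor p ≤ 1 + ‖p‖ := by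
  refine Real.sqrt_le_iff.2 ⟨by positivity, ?_⟩
  nlinarith [norm_sq_plane p, norm_nonneg p]

theorem surfaceCoeff_eq (p : Plane) (i j : Fin 2) : surfaceCoeff i j p =
    (areaFactor p)⁻¹ * !![1 + p 1 ^ 2, -(p 0 * p 1); -(p 0 * p 1), 1 + p 0 ^ 2] i j := by
  have h0 : areaFactor p ≠ 0 := (zero_lt_one.trans_le (one_le_areaFactor p)).ne'
  have hadj : (1 + Matrix.vecMulVec p.ofLp p.ofLp : Matrix (Fin 2) (Fin 2) ℝ).adjugate =
      !![1 + p 1 ^ 2, -(p 0 * p 1); -(p 0 * p 1), 1 + p 0 ^ 2] := by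
    rw [Matrix.adjugate_fin_two]
    simp [Matrix.vecMulVec_apply, sq, mul_comm]
  rw [surfaceCoeff, Matrix.inv_def, hadj, det_metric, Ring.inverse_eq_inv', Matrix.smul_apply,
    smul_eq_mul, ← mul_assoc, ← areaFactor_sq,
    Real.sqrt_sq (zero_le_one.trans (one_le_areaFactor p))]
  congr 1
  field_simp

theorem surfaceCoeff_symm (p : Plane) (i j : Fin 2) : surfaceCoeff i j p = surfaceCoeff j i p := by
  rw [surfaceCoeff_eq, surfaceCoeff_eq]
  fin_cases i <;> fin_cases j <;> rfl

/-- In two dimensions `√|g| g⁻¹` has determinant one. -/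
theorem surfaceCoeff_det (p : Plane) :
    surfaceCoeff 0 0 p * surfaceCoeff 1 1 p - surfaceCoeff 0 1 p ^ 2 = 1 := by
  have h0 : areaFactor p ≠ 0 := (zero_lt_one.trans_le (one_le_areaFactor p)).ne'
  have h1 := areaFactor_sq p
  simp only [surfaceCoeff_eq, Matrix.of_apply, Matrix.cons_val', Matrix.cons_val_zero,
    Matrix.cons_val_one, Matrix.cons_val_fin_one]
  field_simp
  rw [h1]
  ring

theorem le_surfaceCoeff (p : Plane) (x : Fin 2 → ℝ) :
    (areaFactor p)⁻¹ * ∑ i, x i ^ 2 ≤ ∑ i, ∑ j, x i * (surfaceCoeff i j p * x j) := by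
  have h0 : 0 < areaFactor p := zero_lt_one.trans_le (one_le_areaFactor p)
  simp only [surfaceCoeff_eq, Fin.sum_univ_two, Matrix.of_apply, Matrix.cons_val',
    Matrix.cons_val_zero, Matrix.cons_val_one, Matrix.cons_val_fin_one]
  have h1 : 0 ≤ (areaFactor p)⁻¹ * (x 0 * p 1 - x 1 * p 0) ^ 2 := by positivity
  linarith

theorem contDiff_surfaceCoeff (i j : Fin 2) : ContDiff ℝ 1 (surfaceCoeff i j) := by
  have hp : ∀ k : Fin 2, ContDiff ℝ 1 fun p : Plane => p k := fun k =>
    (EuclideanSpace.proj (𝕜 := ℝ) k).contDiff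
  have harea : ContDiff ℝ 1 areaFactor :=
    ((contDiff_const.add ((hp 0).pow 2)).add ((hp 1).pow 2)).sqrt fun p => by positivity
  have hinv : ContDiff ℝ 1 fun p => (areaFactor p)⁻¹ :=
    harea.inv fun p => (zero_lt_one.trans_le (one_le_areaFactor p)).ne'
  rw [funext fun p => surfaceCoeff_eq p i j]
  refine hinv.mul ?_
  fin_cases i <;> fin_cases j
  · exact contDiff_const.add ((hp 1).pow 2)
  · exact ((hp 0).mul (hp 1)).neg
  · exact ((hp 0).mul (hp 1)).neg
  · exact contDiff_const.add ((hp 0).pow 2)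

theorem exists_surfaceCoeff_bound (K : ℝ) : ∃ C : ℝ, 0 ≤ C ∧ ∀ i j, ∀ p : Plane, ‖p‖ ≤ K →
    |surfaceCoeff i j p| ≤ C ∧ ‖fderiv ℝ (surfaceCoeff i j) p‖ ≤ C := by
  have hK := isCompact_closedBall (0 : Plane) K
  have h1 : ∀ i j, ∃ C : ℝ, ∀ p ∈ Metric.closedBall (0 : Plane) K, ‖surfaceCoeff i j p‖ ≤ C :=
    fun i j => hK.exists_bound_of_continuousOn (contDiff_surfaceCoeff i j).continuous.continuousOn
  have h2 : ∀ i j, ∃ C : ℝ, ∀ p ∈ Metric.closedBall (0 : Plane) K,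
      ‖fderiv ℝ (surfaceCoeff i j) p‖ ≤ C := fun i j =>
    hK.exists_bound_of_continuousOn
      ((contDiff_surfaceCoeff i j).continuous_fderiv one_ne_zero).continuousOn
  choose C hC using h1
  choose D hD using h2
  refine ⟨∑ i, ∑ j, (|C i j| + |D i j|), by positivity, fun i j p hp => ?_⟩
  have hle : |C i j| + |D i j| ≤ ∑ i, ∑ j, (|C i j| + |D i j|) :=
    (Finset.single_le_sum (f := fun j => |C i j| + |D i j|) (fun _ _ => by positivity)
      (Finset.mem_univ j)).trans
      (Finset.single_le_sum (f := fun i => ∑ j, (|C i j| + |D i j|)) (fun _ _ => by positivity)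
        (Finset.mem_univ i))
  have hp' : p ∈ Metric.closedBall (0 : Plane) K := by simpa using hp
  constructor
  · have := (hC i j p hp').trans (le_abs_self _)
    rw [Real.norm_eq_abs] at this
    linarith [abs_nonneg (D i j)]
  · have := (hD i j p hp').trans (le_abs_self _)
    linarith [abs_nonneg (C i j)]

end Coefficients

/-! ### The slope of a realisation -/

section Slope

theorem contDiff_gradient (h : Field) : ContDiff ℝ 2 (gradient h) := by
  have h1 : ContDiff ℝ 2 (fderiv ℝ h) := h.2.fderiv_right (by norm_num)
  exact (InnerProductSpace.toDual ℝ Plane).symm.contDiff.comp h1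

theorem gradient_translate (x : Plane) (h : Field) (y : Plane) :
    gradient (translate x h) y = gradient h (y + x) := by
  simp only [gradient]
  congr 1
  exact fderiv_comp_add_right (f := h) x

theorem gradient_apply (h : Field) (x : Plane) (i : Fin 2) :
    gradient h x i = h.jet 1 x fun _ => basisVec i := by
  have h1 : gradient h x i = inner ℝ (gradient h x) (basisVec i) := by
    rw [basisVec, EuclideanSpace.inner_single_right]
    simp
  have h2 : inner ℝ (gradient h x) (basisVec i) = fderiv ℝ h x (basisVec i) :=
    InnerProductSpace.toDual_symm_apply
  rw [h1, h2]
  exact (iteratedFDeriv_one_apply (𝕜 := ℝ) (f := (h : Plane → ℝ)) (x := x)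
    (fun _ => basisVec i)).symm

/-- The slope of the surface at a fixed point depends continuously on the realisation. -/
theorem continuous_gradient (x : Plane) : Continuous fun h : Field => gradient h x := by
  have h1 : ∀ i : Fin 2, Continuous fun h : Field => gradient h x i := fun i => by
    simp only [gradient_apply]
    have h2 : Continuous fun h : Field => h.jet 1 x :=
      (continuous_eval_const x).comp
        ((continuous_apply (1 : Fin 4)).comp isInducing_jet.continuous)
    exact (ContinuousMultilinearMap.apply ℝ (fun _ : Fin ((1 : Fin 4) : ℕ) => Plane) ℝ
      fun _ => basisVec i).continuous.comp h2
  exact (PiLp.continuous_toLp 2 _).comp (continuous_pi h1)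

end Slope

/-! ### Square integrable vector fields -/

section Representatives

variable {Ω : Type*} [MeasurableSpace Ω] {μ : Measure Ω}

theorem memLp_coord {G : Ω → Plane} (hG : MemLp G 2 μ) (i : Fin 2) :
    MemLp (fun ω => G ω i) 2 μ :=
  (EuclideanSpace.proj (𝕜 := ℝ) i : Plane →L[ℝ] ℝ).comp_memLp' hG

theorem memLp_of_coord {G : Ω → Plane} (hG : ∀ i, MemLp (fun ω => G ω i) 2 μ) : MemLp G 2 μ := by
  have h : G = fun ω => ∑ i, G ω i • basisVec i := by
    funext ω
    ext k
    fin_cases k <;> simp [basisVec]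
  rw [h]
  refine memLp_finsetSum _ fun i _ => ?_
  exact ((ContinuousLinearMap.id ℝ ℝ).smulRight (basisVec i)).comp_memLp' (hG i)

theorem inner_basisVec (v : Plane) (i : Fin 2) : inner ℝ v (basisVec i) = v i := by
  rw [basisVec, EuclideanSpace.inner_single_right]
  simp

/-- The class of a square integrable vector field. -/
def vecLp {G : Ω → Plane} (hG : MemLp G 2 μ) : VecField (Lp ℝ 2 μ) :=
  WithLp.toLp 2 fun i => (memLp_coord hG i).toLp fun ω => G ω i

theorem vecLp_apply {G : Ω → Plane} (hG : MemLp G 2 μ) (i : Fin 2) :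
    vecLp hG i = (memLp_coord hG i).toLp fun ω => G ω i := rfl

theorem vecLp_add {G G' : Ω → Plane} (hG : MemLp G 2 μ) (hG' : MemLp G' 2 μ) :
    vecLp (hG.add hG') = vecLp hG + vecLp hG' := rfl

theorem exists_vecLp_eq (V : VecField (Lp ℝ 2 μ)) :
    ∃ (G : Ω → Plane) (hG : MemLp G 2 μ), vecLp hG = V :=
  ⟨fun ω => WithLp.toLp 2 fun i => V i ω, memLp_of_coord fun i => Lp.memLp (V i), by
    ext1 i
    exact Lp.toLp_coeFn (V i) (Lp.memLp (V i))⟩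

theorem inner_matLp_vecLp {a : Fin 2 → Fin 2 → Ω → ℝ} (ha : ∀ i j, MemLp (a i j) ⊤ μ)
    {G G' : Ω → Plane} (hG : MemLp G 2 μ) (hG' : MemLp G' 2 μ) :
    inner ℝ (vecLp hG) (matLp ha (vecLp hG')) =
      ∫ ω, ∑ i, ∑ j, G ω i * (a i j ω * G' ω j) ∂μ := by
  rw [inner_matLp]
  refine integral_congr_ae ?_
  filter_upwards [(memLp_coord hG 0).coeFn_toLp, (memLp_coord hG 1).coeFn_toLp,
    (memLp_coord hG' 0).coeFn_toLp, (memLp_coord hG' 1).coeFn_toLp] with ω h1 h2 h3 h4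
  simp only [Fin.sum_univ_two, vecLp_apply, h1, h2, h3, h4]

end Representatives

/-! ### The environment: coefficients, drift and Dirichlet form -/

section Environment

variable {P : Measure Field}

/-- The entries of `√|g| g⁻¹` at the origin, as functions of the realisation. -/
def envCoeff (i j : Fin 2) (h : Field) : ℝ := surfaceCoeff i j (gradient h 0)

/-- The derivatives `∂_j (√|g| g⁻¹)_{ij}` at the origin. -/
def envCoeffDeriv (i j : Fin 2) (h : Field) : ℝ :=
  fderiv ℝ (fun x => surfaceCoeff i j (gradient h x)) 0 (basisVec j)

theorem envCoeff_translate (i j : Fin 2) (x : Plane) (h : Field) :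
    envCoeff i j (translate x h) = surfaceCoeff i j (gradient h x) := by
  rw [envCoeff, gradient_translate, zero_add]

theorem drift_apply (h : Field) (i : Fin 2) :
    drift h i = (areaElement h 0)⁻¹ * ∑ j, envCoeffDeriv i j h := rfl

theorem one_le_areaElement (h : Field) (x : Plane) : 1 ≤ areaElement h x := by
  rw [areaElement_eq]; exact one_le_areaFactor _

theorem measurable_envCoeff (i j : Fin 2) : Measurable (envCoeff i j) :=
  ((contDiff_surfaceCoeff i j).continuous.comp (continuous_gradient 0)).measurable

theorem measurable_areaElement : Measurable fun h : Field => areaElement h 0 := by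
  simp only [areaElement_eq]
  have h1 : Continuous areaFactor := by unfold areaFactor; fun_prop
  exact (h1.comp (continuous_gradient 0)).measurable

theorem differentiable_surfaceCoeff_gradient (i j : Fin 2) (h : Field) :
    Differentiable ℝ fun x => surfaceCoeff i j (gradient h x) :=
  ((contDiff_surfaceCoeff i j).differentiable one_ne_zero).comp
    ((contDiff_gradient h).differentiable two_ne_zero)

/-- The difference quotients of the coefficients converge to the derivatives. -/
theorem tendsto_envCoeff_slope (i j : Fin 2) (h : Field) :
    Tendsto (fun s : ℝ => s⁻¹ * (envCoeff i j (translate (s • basisVec j) h) - envCoeff i j h))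
      (𝓝[≠] 0) (𝓝 (envCoeffDeriv i j h)) := by
  have h1 : HasDerivAt (fun s : ℝ => s • basisVec j) (basisVec j) 0 := by
    simpa using (hasDerivAt_id (0 : ℝ)).smul_const (basisVec j)
  have h0 : (0 : Plane) = (0 : ℝ) • basisVec j := (zero_smul _ _).symm
  have h2 : HasFDerivAt (fun x => surfaceCoeff i j (gradient h x))
      (fderiv ℝ (fun x => surfaceCoeff i j (gradient h x)) 0) ((0 : ℝ) • basisVec j) := by
    rw [← h0]
    exact (differentiable_surfaceCoeff_gradient i j h 0).hasFDerivAt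
  have h3 := hasDerivAt_iff_tendsto_slope_zero.1 (h2.comp_hasDerivAt 0 h1)
  refine h3.congr fun s => ?_
  rw [envCoeff_translate, envCoeff]
  simp

/-- Measurability of the derivatives, which are limits of difference quotients along `1 / (n + 1)`. -/
theorem measurable_envCoeffDeriv (i j : Fin 2) : Measurable (envCoeffDeriv i j) := by
  have hlim : Tendsto (fun n : ℕ => 1 / ((n : ℝ) + 1)) atTop (𝓝[≠] 0) :=
    tendsto_nhdsWithin_iff.2 ⟨tendsto_one_div_add_atTop_nhds_zero_nat,
      Eventually.of_forall fun n => Nat.one_div_pos_of_nat.ne'⟩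
  refine measurable_of_tendsto_metrizable (f := fun (n : ℕ) h => (1 / ((n : ℝ) + 1))⁻¹ *
    (envCoeff i j (translate ((1 / ((n : ℝ) + 1)) • basisVec j) h) - envCoeff i j h))
    (fun n => ?_) (tendsto_pi_nhds.2 fun h => (tendsto_envCoeff_slope i j h).comp hlim)
  exact (((measurable_envCoeff i j).comp (continuous_translate _).measurable).sub
    (measurable_envCoeff i j)).const_mul _

/-- Almost sure bounds for the coefficients and their derivatives. -/
theorem exists_env_bound (hP : IsAdmissible P) : ∃ C : ℝ, 0 < C ∧ ∀ᵐ h : Field ∂P,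
    areaElement h 0 ≤ C ∧ ∀ i j, |envCoeff i j h| ≤ C ∧
      ∀ x, ‖fderiv ℝ (fun x => surfaceCoeff i j (gradient h x)) x‖ ≤ C := by
  obtain ⟨K, hK, hb⟩ := hP.bounded
  obtain ⟨C, hC, hCb⟩ := exists_surfaceCoeff_bound K
  refine ⟨1 + K + C + C * K, by positivity, ?_⟩
  filter_upwards [hb] with h hh
  have hg : ∀ x, ‖gradient h x‖ ≤ K := fun x => by linarith [hh x, norm_nonneg (fderiv ℝ (gradient h) x)]
  have hd : ∀ x, ‖fderiv ℝ (gradient h) x‖ ≤ K := fun x => by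
    linarith [hh x, norm_nonneg (gradient h x)]
  refine ⟨?_, fun i j => ⟨?_, fun x => ?_⟩⟩
  · rw [areaElement_eq]
    nlinarith [areaFactor_le (gradient h 0), hg 0]
  · have := (hCb i j _ (hg 0)).1
    rw [envCoeff]
    nlinarith
  · have h1 : fderiv ℝ (fun x => surfaceCoeff i j (gradient h x)) x =
        (fderiv ℝ (surfaceCoeff i j) (gradient h x)).comp (fderiv ℝ (gradient h) x) :=
      fderiv_comp x ((contDiff_surfaceCoeff i j).differentiable one_ne_zero _)
        ((contDiff_gradient h).differentiable two_ne_zero _)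
    rw [h1]
    calc _ ≤ ‖fderiv ℝ (surfaceCoeff i j) (gradient h x)‖ * ‖fderiv ℝ (gradient h) x‖ :=
          ContinuousLinearMap.opNorm_comp_le _ _
      _ ≤ C * K := mul_le_mul (hCb i j _ (hg x)).2 (hd x) (norm_nonneg _) hC
      _ ≤ _ := by linarith

theorem memLp_envCoeff (hP : IsAdmissible P) (i j : Fin 2) : MemLp (envCoeff i j) ⊤ P := by
  obtain ⟨C, -, hC⟩ := exists_env_bound hP
  refine memLp_top_of_bound (measurable_envCoeff i j).aestronglyMeasurable C ?_
  filter_upwards [hC] with h hh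
  exact (hh.2 i j).1

theorem memLp_areaElement (hP : IsAdmissible P) :
    MemLp (fun h : Field => areaElement h 0) ⊤ P := by
  obtain ⟨C, -, hC⟩ := exists_env_bound hP
  refine memLp_top_of_bound measurable_areaElement.aestronglyMeasurable C ?_
  filter_upwards [hC] with h hh
  rw [Real.norm_of_nonneg (zero_le_one.trans (one_le_areaElement h 0))]
  exact hh.1

theorem norm_basisVec (j : Fin 2) : ‖basisVec j‖ = 1 := by
  simp [basisVec]

theorem abs_envCoeffDeriv_le {C : ℝ} {h : Field} {i j : Fin 2}
    (hC : ∀ x, ‖fderiv ℝ (fun x => surfaceCoeff i j (gradient h x)) x‖ ≤ C) :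
    |envCoeffDeriv i j h| ≤ C := by
  have := (fderiv ℝ (fun x => surfaceCoeff i j (gradient h x)) 0).le_opNorm (basisVec j)
  rw [norm_basisVec, mul_one] at this
  exact this.trans (hC 0)

theorem memLp_envCoeffDeriv (hP : IsAdmissible P) (i j : Fin 2) :
    MemLp (envCoeffDeriv i j) ⊤ P := by
  obtain ⟨C, -, hC⟩ := exists_env_bound hP
  refine memLp_top_of_bound (measurable_envCoeffDeriv i j).aestronglyMeasurable C ?_
  filter_upwards [hC] with h hh
  exact abs_envCoeffDeriv_le (hh.2 i j).2

/-- The operator of multiplication by `√|g| g⁻¹` on square integrable vector fields. -/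
def envOp (hP : IsAdmissible P) : VecField (Lp ℝ 2 P) →L[ℝ] VecField (Lp ℝ 2 P) :=
  matLp (memLp_envCoeff hP)

/-- The operator of multiplication by `√|g|` on `L²(P)`. -/
def areaOp (hP : IsAdmissible P) : Lp ℝ 2 P →L[ℝ] Lp ℝ 2 P := mulLp (memLp_areaElement hP)

theorem areaOp_toLp (hP : IsAdmissible P) {f : Field → ℝ} (hf : MemLp f 2 P) :
    areaOp hP (hf.toLp f) =ᵐ[P] fun h => areaElement h 0 * f h := by
  filter_upwards [coeFn_mulLp (memLp_areaElement hP) (hf.toLp f), hf.coeFn_toLp] with h h1 h2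
  rw [areaOp, h1, h2]

theorem isElliptic_areaOp (hP : IsAdmissible P) : IsElliptic (areaOp hP) :=
  isElliptic_mulLp _ zero_lt_one (Eventually.of_forall fun h => one_le_areaElement h 0)

theorem isElliptic_envOp (hP : IsAdmissible P) : IsElliptic (envOp hP) := by
  obtain ⟨C, hC0, hC⟩ := exists_env_bound hP
  refine isElliptic_matLp (memLp_envCoeff hP) (fun h i j => surfaceCoeff_symm _ i j) (inv_pos.2 hC0) ?_
  filter_upwards [hC] with h hh x
  refine le_trans ?_ (le_surfaceCoeff (gradient h 0) x)
  refine mul_le_mul_of_nonneg_right ?_ (Finset.sum_nonneg fun i _ => sq_nonneg _)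
  rw [← areaElement_eq]
  exact inv_anti₀ (zero_lt_one.trans_le (one_le_areaElement h 0)) hh.1

theorem envOp_quarterTurn (hP : IsAdmissible P) (W : VecField (Lp ℝ 2 P)) :
    envOp hP (quarterTurn (envOp hP W)) = quarterTurn W :=
  matLp_quarterTurn (memLp_envCoeff hP) (fun h i j => surfaceCoeff_symm (gradient h 0) i j)
    (fun h => surfaceCoeff_det (gradient h 0)) W

theorem one_le_avgArea (hP : IsAdmissible P) : 1 ≤ avgArea P := by
  have := hP.prob
  have h1 : Integrable (fun h : Field => areaElement h 0) P :=
    (memLp_areaElement hP).integrable le_top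
  have h2 : ∫ _ : Field, (1 : ℝ) ∂P ≤ avgArea P :=
    integral_mono (integrable_const _) h1 fun h => one_le_areaElement h 0
  simpa using h2

variable (hP : IsAdmissible P)

theorem isGen_toLp_iff (x : Plane) {u w : Field → ℝ} (hu : MemLp u 2 P) (hw : MemLp w 2 P) :
    IsGen (shift hP) x (hu.toLp u) (hw.toLp w) ↔ Tendsto (fun s : ℝ => eLpNorm
      (fun h => s⁻¹ * (u (translate (s • x) h) - u h) - w h) 2 P) (𝓝[≠] 0) (𝓝 0) := by
  rw [isGen_iff_tendsto (isUnitaryRep_shift hP)]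
  have hmem : ∀ s : ℝ, MemLp (fun h => s⁻¹ * (u (translate (s • x) h) - u h)) 2 P := fun s =>
    ((hu.comp_measurePreserving (hP.measurePreserving _)).sub hu).const_mul _
  have h1 : ∀ s : ℝ, s⁻¹ • (shift hP (s • x) (hu.toLp u) - hu.toLp u) = (hmem s).toLp _ :=
    fun s => rfl
  simp only [h1]
  exact Lp.tendsto_Lp_iff_tendsto_eLpNorm'' _ _ _ _

/-- `HasGrad` is membership in the graph of the gradient for the group of translations. -/
theorem hasGrad_iff {u : Field → ℝ} {G : Field → Plane} (hu : MemLp u 2 P) (hG : MemLp G 2 P) :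
    HasGrad P u G ↔ WithLp.toLp 2 (hu.toLp u, vecLp hG) ∈ gradGraph (shift hP) := by
  rw [mem_gradGraph]
  constructor
  · intro h i
    exact (isGen_toLp_iff hP (basisVec i) hu (memLp_coord hG i)).2 (h.tendsto i)
  · intro h
    exact ⟨hu, hG, fun i => (isGen_toLp_iff hP (basisVec i) hu (memLp_coord hG i)).1 (h i)⟩

/-- The coefficients are in the domain of the generators, with the pathwise derivatives. -/
theorem isGen_envCoeff [IsFiniteMeasure P] (i j : Fin 2) : IsGen (shift hP) (basisVec j)
    (((memLp_envCoeff hP i j).mono_exponent le_top).toLp _)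
    (((memLp_envCoeffDeriv hP i j).mono_exponent le_top).toLp _) := by
  rw [isGen_toLp_iff]
  obtain ⟨C, hC0, hC⟩ := exists_env_bound hP
  refine tendsto_eLpNorm_two_of_bounded (C := C + C) (Eventually.of_forall fun s => ?_)
    (Eventually.of_forall fun s => ?_) (Eventually.of_forall fun h => ?_)
  · exact ((((measurable_envCoeff i j).comp (continuous_translate _).measurable).sub
      (measurable_envCoeff i j)).const_mul _).sub (measurable_envCoeffDeriv i j)
  · filter_upwards [hC] with h hh
    refine (abs_sub _ _).trans (add_le_add ?_ (abs_envCoeffDeriv_le (hh.2 i j).2))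
    have h1 := Convex.norm_image_sub_le_of_norm_fderiv_le (𝕜 := ℝ) (s := Set.univ)
      (f := fun x => surfaceCoeff i j (gradient h x)) (x := 0) (y := s • basisVec j)
      (fun x _ => differentiable_surfaceCoeff_gradient i j h x)
      (fun x _ => (hh.2 i j).2 x) convex_univ (Set.mem_univ _) (Set.mem_univ _)
    rw [sub_zero, norm_smul, norm_basisVec, mul_one, Real.norm_eq_abs, Real.norm_eq_abs] at h1
    rw [envCoeff_translate, envCoeff, abs_mul, abs_inv]
    rcases eq_or_ne s 0 with rfl | hs
    · simpa using hC0.le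
    · rw [inv_mul_le_iff₀ (abs_pos.2 hs), mul_comm]
      exact h1
  · have := (tendsto_envCoeff_slope i j h).sub_const (envCoeffDeriv i j h)
    rwa [sub_self] at this

theorem dirichletForm_eq {G G' : Field → Plane} (hG : MemLp G 2 P) (hG' : MemLp G' 2 P) :
    dirichletForm P G G' = (avgArea P)⁻¹ * inner ℝ (vecLp hG) (envOp hP (vecLp hG')) := by
  rw [envOp, inner_matLp_vecLp, dirichletForm]
  congr 2
  funext h
  simp only [envCoeff, ← areaElement_mul_inv, dotProduct, Matrix.mulVec, Fin.sum_univ_two]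
  ring

theorem integral_envMeasure (hP : IsAdmissible P) (f : Field → ℝ) :
    ∫ h, f h ∂(envMeasure P) = (avgArea P)⁻¹ * ∫ h, areaElement h 0 * f h ∂P := by
  have hm : Measurable fun h : Field => ENNReal.ofReal (areaElement h 0 / avgArea P) :=
    (measurable_areaElement.div_const _).ennreal_ofReal
  rw [envMeasure, integral_withDensity_eq_integral_toReal_smul hm
    (Eventually.of_forall fun _ => ENNReal.ofReal_lt_top), ← integral_const_mul]
  congr 1
  funext h
  have h1 : 0 ≤ areaElement h 0 / avgArea P :=
    div_nonneg (zero_le_one.trans (one_le_areaElement h 0))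
      (zero_le_one.trans (one_le_avgArea hP))
  rw [ENNReal.toReal_ofReal h1, smul_eq_mul]
  ring

/-- `π` has a bounded density with respect to `P`. -/
theorem memLp_envMeasure (hP : IsAdmissible P) {f : Field → ℝ} (hf : MemLp f 2 P) : MemLp f 2 (envMeasure P) := by
  obtain ⟨C, hC0, hC⟩ := exists_env_bound hP
  refine hf.of_measure_le_smul (c := ENNReal.ofReal C) ENNReal.ofReal_ne_top ?_
  rw [envMeasure, ← withDensity_const]
  refine withDensity_mono ?_
  filter_upwards [hC] with h hh
  refine ENNReal.ofReal_le_ofReal ((div_le_self ?_ (one_le_avgArea hP)).trans hh.1)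
  exact zero_le_one.trans (one_le_areaElement h 0)

end Environment

/-! ### The resolvent equation and corrector gradients -/

section Correctors

variable {P : Measure Field} [IsProbabilityMeasure P] (hP : IsAdmissible P)

/-- The flux `√|g| g⁻¹ e_i` of a constant field. -/
theorem envOp_constField (i k : Fin 2) :
    envOp hP (constField (oneLp P) (Pi.single i 1)) k =
      ((memLp_envCoeff hP i k).mono_exponent le_top).toLp _ := by
  refine Lp.ext ?_
  have hone : ∀ j : Fin 2, constField (oneLp P) (Pi.single i 1) j =ᵐ[P]
      fun _ => (Pi.single i 1 : Fin 2 → ℝ) j := fun j => by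
    filter_upwards [Lp.coeFn_smul ((Pi.single i 1 : Fin 2 → ℝ) j) (oneLp P),
      (memLp_const (1 : ℝ)).coeFn_toLp (μ := P) (p := 2)] with h h1 h2
    rw [constField_apply, h1, Pi.smul_apply, oneLp, h2, smul_eq_mul, mul_one]
  filter_upwards [coeFn_matLp (memLp_envCoeff hP) (constField (oneLp P) (Pi.single i 1)) k,
    hone 0, hone 1, ((memLp_envCoeff hP i k).mono_exponent le_top).coeFn_toLp]
    with h h1 h2 h3 h4
  have hs : envCoeff i k h = envCoeff k i h := surfaceCoeff_symm (gradient h 0) i k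
  rw [h4, hs, envOp, h1, h2, h3]
  fin_cases i <;> simp

/-- The class of `√|g| F_i`, the divergence of the `i`-th row of `√|g| g⁻¹`. -/
def driftLp (i : Fin 2) : Lp ℝ 2 P :=
  ∑ j, ((memLp_envCoeffDeriv hP i j).mono_exponent le_top).toLp _

/-- Integration by parts for the drift. -/
theorem inner_envOp_constField (i : Fin 2) {y : WithLp 2 (Lp ℝ 2 P × VecField (Lp ℝ 2 P))}
    (hy : y ∈ gradGraph (shift hP)) :
    inner ℝ y.snd (envOp hP (constField (oneLp P) (Pi.single i 1))) =
      -inner ℝ y.fst (driftLp hP i) := by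
  rw [PiLp.inner_apply, driftLp, inner_sum, ← Finset.sum_neg_distrib]
  refine Finset.sum_congr rfl fun j _ => ?_
  rw [envOp_constField]
  exact IsGen.inner_skew (isUnitaryRep_shift hP) (hy j) (isGen_envCoeff hP i j)

theorem memLp_drift (hP : IsAdmissible P) (i : Fin 2) : MemLp (fun h => drift h i) 2 P := by
  have h1 : MemLp (fun h => ∑ j, envCoeffDeriv i j h) 2 P :=
    memLp_finsetSum _ fun j _ => (memLp_envCoeffDeriv hP i j).mono_exponent le_top
  refine h1.mono ?_ (Eventually.of_forall fun h => ?_)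
  · simp only [drift_apply]
    exact (measurable_areaElement.inv.mul
      (Finset.measurable_sum _ fun j _ => measurable_envCoeffDeriv i j)).aestronglyMeasurable
  · have h2 := one_le_areaElement h 0
    rw [drift_apply, norm_mul, norm_inv, Real.norm_of_nonneg (zero_le_one.trans h2)]
    exact mul_le_of_le_one_left (norm_nonneg _) (inv_le_one_of_one_le₀ h2)

/-- The pairing of `-ℒχ = F_i - l χ` with `ψ` in `L²(π)`, as inner products in `L²(P)`. -/
theorem integral_generator (l : ℝ) (i : Fin 2) {χ ψ : Field → ℝ} (hχ : MemLp χ 2 P)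
    (hψ : MemLp ψ 2 P) :
    ∫ h, (-(l * χ h - inner ℝ (drift h) (basisVec i))) * ψ h ∂(envMeasure P) =
      (avgArea P)⁻¹ * (-(l * inner ℝ (hψ.toLp ψ) (areaOp hP (hχ.toLp χ))) +
        inner ℝ (hψ.toLp ψ) (driftLp hP i)) := by
  rw [integral_envMeasure hP, ← inner_smul_right, ← inner_neg_right, ← inner_add_right,
    L2.inner_def]
  congr 1
  refine integral_congr_ae ?_
  filter_upwards [hψ.coeFn_toLp, Lp.coeFn_add (-(l • areaOp hP (hχ.toLp χ))) (driftLp hP i),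
    Lp.coeFn_neg (l • areaOp hP (hχ.toLp χ)), Lp.coeFn_smul l (areaOp hP (hχ.toLp χ)),
    areaOp_toLp hP hχ, Lp.coeFn_finsetSum Finset.univ
      (fun j => ((memLp_envCoeffDeriv hP i j).mono_exponent le_top).toLp (p := 2) _),
    ((memLp_envCoeffDeriv hP i 0).mono_exponent (p := 2) le_top).coeFn_toLp,
    ((memLp_envCoeffDeriv hP i 1).mono_exponent (p := 2) le_top).coeFn_toLp]
    with h h1 h2 h3 h4 h5 h6 h7 h8
  have h9 : driftLp hP i h = envCoeffDeriv i 0 h + envCoeffDeriv i 1 h := by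
    rw [driftLp, h6]
    simp only [Finset.sum_apply, Fin.sum_univ_two, h7, h8]
  have h0 : areaElement h 0 ≠ 0 := (zero_lt_one.trans_le (one_le_areaElement h 0)).ne'
  rw [h1, h2, Pi.add_apply, h3, Pi.neg_apply, h4, Pi.smul_apply, h5, h9, inner_basisVec,
    drift_apply, Fin.sum_univ_two]
  change _ = (-(l * (areaElement h 0 * χ h)) + (envCoeffDeriv i 0 h + envCoeffDeriv i 1 h)) * ψ h
  field_simp
  ring

/-- The resolvent equation in weak form on the graph of the gradient. -/
theorem isResolventCorrector_iff (l : ℝ) (i : Fin 2) {χ : Field → ℝ} {G : Field → Plane}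
    (hχ : MemLp χ 2 P) (hG : MemLp G 2 P) (h : HasGrad P χ G) :
    IsResolventCorrector P l (basisVec i) χ ↔ ∀ y ∈ gradGraph (shift hP),
      l * inner ℝ y.fst (areaOp hP (hχ.toLp χ)) +
        inner ℝ y.snd (envOp hP (constField (oneLp P) (Pi.single i 1) + vecLp hG)) = 0 := by
  have hZ : (avgArea P)⁻¹ ≠ 0 := (inv_pos.2 (zero_lt_one.trans_le (one_le_avgArea hP))).ne'
  have hE := isElliptic_envOp hP
  have key : ∀ {ψ : Field → ℝ} {Gψ : Field → Plane} (hψ : MemLp ψ 2 P) (hGψ : MemLp Gψ 2 P),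
      HasGrad P ψ Gψ →
      ((∫ h, (-(l * χ h - inner ℝ (drift h) (basisVec i))) * ψ h ∂(envMeasure P) =
        dirichletForm P G Gψ) ↔ l * inner ℝ (hψ.toLp ψ) (areaOp hP (hχ.toLp χ)) +
        inner ℝ (vecLp hGψ) (envOp hP (constField (oneLp P) (Pi.single i 1) + vecLp hG)) = 0) := by
    intro ψ Gψ hψ hGψ hg
    have hb := inner_envOp_constField hP i ((hasGrad_iff hP hψ hGψ).1 hg)
    change inner ℝ (vecLp hGψ) _ = -inner ℝ (hψ.toLp ψ) _ at hb
    rw [integral_generator hP l i hχ hψ, dirichletForm_eq hP hG hGψ, mul_right_inj' hZ, map_add,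
      inner_add_right, hb, hE.symm (vecLp hG)]
    constructor <;> intro h <;> linarith
  constructor
  · rintro ⟨-, G', hG', heq⟩ y hy
    -- The gradient in the definition of the generator is the given one, by uniqueness of limits.
    have hGG : vecLp hG'.memLp_grad = vecLp hG := by
      ext1 k
      exact IsGen.unique ((hasGrad_iff hP hχ hG'.memLp_grad).1 hG' k)
        ((hasGrad_iff hP hχ hG).1 h k)
    obtain ⟨Gψ, hGψ, hGy⟩ := exists_vecLp_eq y.snd
    have hy' : WithLp.toLp 2 ((Lp.memLp y.fst).toLp _, vecLp hGψ) ∈ gradGraph (shift hP) := by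
      rw [hGy, Lp.toLp_coeFn]
      exact hy
    have hgψ := (hasGrad_iff hP (Lp.memLp y.fst) hGψ).2 hy'
    have h1 := heq _ _ hgψ
    rw [dirichletForm_eq hP hG'.memLp_grad hGψ, hGG, ← dirichletForm_eq hP hG hGψ] at h1
    have h2 := (key (Lp.memLp y.fst) hGψ hgψ).1 h1
    rwa [hGy, Lp.toLp_coeFn] at h2
  · intro heq
    refine ⟨memLp_envMeasure hP ?_, G, h, fun ψ Gψ hg => ?_⟩
    · simp only [inner_basisVec]
      exact (hχ.const_mul l).sub (memLp_drift hP i)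
    · exact (key hg.memLp_fun hg.memLp_grad hg).2
        (heq _ ((hasGrad_iff hP hg.memLp_fun hg.memLp_grad).1 hg))

/-- Corrector gradients are the potential fields `V` for which `√|g| g⁻¹ (e_i + V)` is
divergence-free. -/
theorem isCorrectorGradient_iff (i : Fin 2) {V : Field → Plane} (hV : MemLp V 2 P) :
    IsCorrectorGradient P (basisVec i) V ↔ vecLp hV ∈ potential (shift hP) ∧
      ∀ W ∈ potential (shift hP),
        inner ℝ W (envOp hP (constField (oneLp P) (Pi.single i 1) + vecLp hV)) = 0 := by
  have hE := isElliptic_envOp hP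
  have hB := isElliptic_areaOp hP
  have hZ : 0 < avgArea P := zero_lt_one.trans_le (one_le_avgArea hP)
  constructor
  · rintro ⟨-, χ, G, hχG, hlim⟩
    obtain ⟨V₀, hV₀, hV₀W⟩ := exists_potential_corrector (U := shift hP) hE
      (constField (oneLp P) (Pi.single i 1))
    have hz : ∀ l, 0 < l → ∃ z ∈ gradGraph (shift hP), (∀ y ∈ gradGraph (shift hP),
        l * inner ℝ y.fst (areaOp hP z.fst) +
          inner ℝ y.snd (envOp hP (constField (oneLp P) (Pi.single i 1) + z.snd)) = 0) ∧
        dirichletForm P (fun h => G l h - V h) (fun h => G l h - V h) = (avgArea P)⁻¹ *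
          inner ℝ (z.snd - vecLp hV) (envOp hP (z.snd - vecLp hV)) := by
      intro l hl
      obtain ⟨h1, h2⟩ := hχG l hl
      exact ⟨_, (hasGrad_iff hP h2.memLp_fun h2.memLp_grad).1 h2,
        (isResolventCorrector_iff hP l i h2.memLp_fun h2.memLp_grad h2).1 h1,
        dirichletForm_eq hP (h2.memLp_grad.sub hV) (h2.memLp_grad.sub hV)⟩
    choose! z hz1 hz2 hz3 using hz
    have hl0 := tendsto_resolvent hE hB hV₀ hV₀W hz1 hz2
    have hl1 : Tendsto (fun l => inner ℝ ((z l).snd - vecLp hV)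
        (envOp hP ((z l).snd - vecLp hV))) (𝓝[>] 0) (𝓝 0) := by
      have := hlim.const_mul (avgArea P)
      rw [mul_zero] at this
      refine this.congr' ?_
      filter_upwards [self_mem_nhdsWithin] with l hl
      rw [hz3 l hl, mul_inv_cancel_left₀ hZ.ne']
    -- The resolvent gradients converge in energy both to `V₀` and to `V`.
    have hle : inner ℝ (V₀ - vecLp hV) (envOp hP (V₀ - vecLp hV)) ≤ 0 := by
      have hl2 := (hl0.const_mul 2).add (hl1.const_mul 2)
      rw [mul_zero, add_zero] at hl2
      refine ge_of_tendsto' hl2 fun l => ?_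
      have h1 := hE.inner_sub_le V₀ (z l).snd (vecLp hV)
      have h2 : inner ℝ (V₀ - (z l).snd) (envOp hP (V₀ - (z l).snd)) =
          inner ℝ ((z l).snd - V₀) (envOp hP ((z l).snd - V₀)) := by
        rw [← neg_sub (z l).snd V₀, map_neg, inner_neg_neg]
      rwa [h2] at h1
    have heq : V₀ = vecLp hV := sub_eq_zero.1 (hE.eq_zero hle)
    rw [← heq]
    exact ⟨hV₀, hV₀W⟩
  · rintro ⟨hpot, horth⟩
    have hz : ∀ l : ℝ, 0 < l → ∃ (χ : Field → ℝ) (G : Field → Plane) (hχ : MemLp χ 2 P)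
        (hG : MemLp G 2 P), HasGrad P χ G ∧ IsResolventCorrector P l (basisVec i) χ ∧
        ∀ y ∈ gradGraph (shift hP), l * inner ℝ y.fst (areaOp hP (hχ.toLp χ)) +
          inner ℝ y.snd (envOp hP (constField (oneLp P) (Pi.single i 1) + vecLp hG)) = 0 := by
      intro l hl
      obtain ⟨z, hz, hzy⟩ := exists_resolvent (isUnitaryRep_shift hP) hE hB hl
        (constField (oneLp P) (Pi.single i 1))
      obtain ⟨G, hG, hGz⟩ := exists_vecLp_eq z.snd
      have hz' : WithLp.toLp 2 ((Lp.memLp z.fst).toLp _, vecLp hG) ∈ gradGraph (shift hP) := by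
        rw [hGz, Lp.toLp_coeFn]
        exact hz
      have hg := (hasGrad_iff hP (Lp.memLp z.fst) hG).2 hz'
      have hzy' : ∀ y ∈ gradGraph (shift hP),
          l * inner ℝ y.fst (areaOp hP ((Lp.memLp z.fst).toLp _)) +
          inner ℝ y.snd (envOp hP (constField (oneLp P) (Pi.single i 1) + vecLp hG)) = 0 := by
        rw [hGz, Lp.toLp_coeFn]
        exact hzy
      exact ⟨_, G, Lp.memLp z.fst, hG, hg,
        (isResolventCorrector_iff hP l i (Lp.memLp z.fst) hG hg).2 hzy', hzy'⟩
    choose! χ G hχ hG hg hr hy using hz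
    refine ⟨hV, χ, G, fun l hl => ⟨hr l hl, hg l hl⟩, ?_⟩
    let z : ℝ → WithLp 2 (Lp ℝ 2 P × VecField (Lp ℝ 2 P)) := fun l =>
      if hl : 0 < l then WithLp.toLp 2 ((hχ l hl).toLp _, vecLp (hG l hl)) else 0
    have hzl : ∀ l, ∀ hl : 0 < l, z l = WithLp.toLp 2 ((hχ l hl).toLp _, vecLp (hG l hl)) :=
      fun l hl => dif_pos hl
    have hl0 := tendsto_resolvent hE hB hpot horth (z := z)
      (fun l hl => by rw [hzl l hl]; exact (hasGrad_iff hP (hχ l hl) (hG l hl)).1 (hg l hl))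
      (fun l hl => by rw [hzl l hl]; exact hy l hl)
    have := hl0.const_mul (avgArea P)⁻¹
    rw [mul_zero] at this
    refine this.congr' ?_
    filter_upwards [self_mem_nhdsWithin] with l hl
    rw [hzl l hl]
    exact (dirichletForm_eq hP ((hG l hl).sub hV) ((hG l hl).sub hV)).symm

end Correctors

/-! ### Rotations -/

section Rotation

/-- The inverse rotation `x ↦ Qᵀ x` of the plane. -/
def rotInv (θ : Real.Angle) : Plane →L[ℝ] Plane :=
  Matrix.toEuclideanCLM (𝕜 := ℝ) (rotMatrix θ)ᵀ

theorem rotInv_apply_zero (θ : Real.Angle) (x : Plane) :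
    rotInv θ x 0 = θ.cos * x 0 + θ.sin * x 1 := by
  simp [rotInv, Matrix.ofLp_toEuclideanCLM, rotMatrix, Matrix.mulVec, dotProduct,
    Fin.sum_univ_two]

theorem rotInv_apply_one (θ : Real.Angle) (x : Plane) :
    rotInv θ x 1 = -θ.sin * x 0 + θ.cos * x 1 := by
  simp [rotInv, Matrix.ofLp_toEuclideanCLM, rotMatrix, Matrix.mulVec, dotProduct,
    Fin.sum_univ_two]

/-- The rotation `h ↦ h (Qᵀ ·)` about the origin. -/
def originRotate (θ : Real.Angle) (h : Field) : Field := rotate (rotMatrix θ) 0 h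

theorem originRotate_apply (θ : Real.Angle) (h : Field) (x : Plane) :
    originRotate θ h x = h (rotInv θ x) := by
  change h (0 + rotInv θ (x - 0)) = _
  rw [zero_add, sub_zero]

theorem originRotate_coe (θ : Real.Angle) (h : Field) :
    (originRotate θ h : Plane → ℝ) = h ∘ rotInv θ :=
  funext fun x => originRotate_apply θ h x

/-- A rotation about `c` is a translation followed by a rotation about the origin. -/
theorem rotate_eq (θ : Real.Angle) (c : Plane) (h : Field) :
    rotate (rotMatrix θ) c h = originRotate θ (translate (c - rotInv θ c) h) := by
  apply Subtype.ext
  funext x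
  rw [originRotate_apply]
  change h (c + rotInv θ (x - c)) = h (rotInv θ x + (c - rotInv θ c))
  rw [map_sub]
  exact congrArg h (by abel)

/-- The commutation relation `R τ_{Qᵀw} = τ_w R`. -/
theorem originRotate_translate (θ : Real.Angle) (w : Plane) (h : Field) :
    originRotate θ (translate (rotInv θ w) h) = translate w (originRotate θ h) := by
  apply Subtype.ext
  funext x
  rw [originRotate_apply]
  change h (rotInv θ x + rotInv θ w) = originRotate θ h (x + w)
  rw [originRotate_apply, map_add]

theorem continuous_originRotate (θ : Real.Angle) : Continuous (originRotate θ) := by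
  refine isInducing_jet.continuous_iff.2 (continuous_pi fun k => ?_)
  refine ContinuousMap.continuous_of_continuous_uncurry _ ?_
  have h1 : Continuous fun q : Field × Plane => q.1.jet k :=
    (continuous_apply k).comp (isInducing_jet.continuous.comp continuous_fst)
  have h2 : Continuous fun q : Field × Plane => rotInv θ q.2 :=
    (rotInv θ).continuous.comp continuous_snd
  have h3 := (ContinuousMultilinearMap.compContinuousLinearMapL (F := ℝ)
    (fun _ : Fin (k : ℕ) => rotInv θ)).continuous.comp (h1.eval h2)
  refine h3.congr fun q => ?_
  have hk : ((k : ℕ) : WithTop ℕ∞) ≤ 3 := by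
    have h3 : ((k : ℕ) : ℕ∞) ≤ (3 : ℕ) := by exact_mod_cast Nat.lt_succ_iff.mp k.2
    exact_mod_cast h3
  have h4 := (rotInv θ).iteratedFDeriv_comp_right q.1.2 q.2 (i := (k : ℕ)) hk
  change _ = iteratedFDeriv ℝ (k : ℕ) (originRotate θ q.1) q.2
  rw [originRotate_coe]
  exact h4.symm

/-- The slope is covariant: `∇(R h)(0) = Q ∇h(0)`. -/
theorem gradient_originRotate (θ : Real.Angle) (h : Field) (i : Fin 2) :
    gradient (originRotate θ h) 0 i = inner ℝ (gradient h 0) (rotInv θ (basisVec i)) := by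
  have h1 : HasFDerivAt (originRotate θ h) ((fderiv ℝ h 0).comp (rotInv θ)) 0 := by
    rw [originRotate_coe]
    refine HasFDerivAt.comp 0 ?_ (rotInv θ).hasFDerivAt
    rw [map_zero]
    exact (h.2.differentiable (by norm_num) 0).hasFDerivAt
  rw [← inner_basisVec]
  have h2 : ∀ (f : Field) (v : Plane), inner ℝ (gradient f 0) v = fderiv ℝ f 0 v := fun f v =>
    InnerProductSpace.toDual_symm_apply
  rw [h2, h2, h1.fderiv]
  rfl

/-- The metric at the origin is covariant under rotations. -/
theorem envCoeff_originRotate (θ : Real.Angle) (h : Field) (y z : Fin 2 → ℝ)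
    (hz0 : z 0 = θ.cos * y 0 + θ.sin * y 1) (hz1 : z 1 = -θ.sin * y 0 + θ.cos * y 1) :
    ∑ i, ∑ j, z i * (envCoeff i j h * z j) =
      ∑ i, ∑ j, y i * (envCoeff i j (originRotate θ h) * y j) := by
  have hcs : θ.cos ^ 2 + θ.sin ^ 2 = 1 := θ.cos_sq_add_sin_sq
  set p := gradient h 0 with hp
  set q := gradient (originRotate θ h) 0 with hq
  have hi : ∀ v : Plane, inner ℝ p v = p 0 * v 0 + p 1 * v 1 := fun v => by
    rw [PiLp.inner_apply, Fin.sum_univ_two]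
    simp [mul_comm]
  have hq0 : q 0 = θ.cos * p 0 - θ.sin * p 1 := by
    rw [hq, gradient_originRotate, ← hp, hi, rotInv_apply_zero, rotInv_apply_one]
    simp [basisVec]
    ring
  have hq1 : q 1 = θ.sin * p 0 + θ.cos * p 1 := by
    rw [hq, gradient_originRotate, ← hp, hi, rotInv_apply_zero, rotInv_apply_one]
    simp [basisVec]
    ring
  have harea : areaFactor q = areaFactor p := by
    unfold areaFactor
    congr 1
    rw [hq0, hq1]
    linear_combination (p 0 ^ 2 + p 1 ^ 2) * hcs
  have hform : ∀ (r : Plane) (x : Fin 2 → ℝ), ∑ i, ∑ j, x i * (surfaceCoeff i j r * x j) =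
      (areaFactor r)⁻¹ * (x 0 ^ 2 + x 1 ^ 2 + (x 0 * r 1 - x 1 * r 0) ^ 2) := fun r x => by
    simp only [surfaceCoeff_eq, Fin.sum_univ_two, Matrix.of_apply, Matrix.cons_val',
      Matrix.cons_val_zero, Matrix.cons_val_one, Matrix.cons_val_fin_one]
    ring
  have e1 : z 0 * p 1 - z 1 * p 0 = y 0 * q 1 - y 1 * q 0 := by
    rw [hz0, hz1, hq0, hq1]; ring
  have e2 : z 0 ^ 2 + z 1 ^ 2 = y 0 ^ 2 + y 1 ^ 2 := by
    rw [hz0, hz1]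
    linear_combination (y 0 ^ 2 + y 1 ^ 2) * hcs
  simp only [envCoeff]
  rw [← hp, ← hq, hform, hform, harea, e1, e2]

variable {P : Measure Field}

/-- A stationary law that is invariant under the rotation about some point is invariant under the
rotation about the origin. -/
theorem measurePreserving_originRotate (hP : IsAdmissible P) {θ : Real.Angle} {c : Plane}
    (hinv : ∀ B : Set Field, MeasurableSet B → P (rotate (rotMatrix θ) c ⁻¹' B) = P B) :
    MeasurePreserving (originRotate θ) P P := by
  have hm := (continuous_originRotate θ).measurable
  refine ⟨hm, Measure.ext fun B hB => ?_⟩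
  rw [Measure.map_apply hm hB, ← hinv B hB, ← hP.stationary (c - rotInv θ c) _ (hm hB)]
  congr 1
  ext h
  simp only [Set.mem_preimage, rotate_eq]

/-- The action of a measure preserving rotation on `L²(P)`. -/
def rotLp {θ : Real.Angle} (hR : MeasurePreserving (originRotate θ) P P) :
    Lp ℝ 2 P →L[ℝ] Lp ℝ 2 P :=
  (Lp.compMeasurePreservingₗᵢ ℝ (originRotate θ) hR).toContinuousLinearMap

theorem coeFn_rotLp {θ : Real.Angle} (hR : MeasurePreserving (originRotate θ) P P)
    (f : Lp ℝ 2 P) : rotLp hR f =ᵐ[P] fun h => f (originRotate θ h) :=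
  Lp.coeFn_compMeasurePreserving f hR

theorem shift_rotLp (hP : IsAdmissible P) {θ : Real.Angle}
    (hR : MeasurePreserving (originRotate θ) P P) (w : Plane) (f : Lp ℝ 2 P) :
    shift hP (rotInv θ w) (rotLp hR f) = rotLp hR (shift hP w f) := by
  refine Lp.ext ?_
  filter_upwards [coeFn_shift hP (rotInv θ w) (rotLp hR f), coeFn_rotLp hR (shift hP w f),
    (hP.measurePreserving (rotInv θ w)).quasiMeasurePreserving.ae (coeFn_rotLp hR f),
    hR.quasiMeasurePreserving.ae (coeFn_shift hP w f)] with h h1 h2 h3 h4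
  rw [h1, h2, h3, h4, originRotate_translate]

theorem IsGen.rotLp (hP : IsAdmissible P) {θ : Real.Angle}
    (hR : MeasurePreserving (originRotate θ) P P) {w : Plane} {u v : Lp ℝ 2 P}
    (h : IsGen (shift hP) w u v) :
    IsGen (shift hP) (rotInv θ w) (rotLp hR u) (rotLp hR v) := by
  have := (RandomSurface.rotLp hR).hasFDerivAt.comp_hasDerivAt 0 h
  refine this.congr_of_eventuallyEq (Eventually.of_forall fun t => ?_)
  change shift hP (t • rotInv θ w) _ = _
  rw [← map_smul, shift_rotLp]
  rfl

/-- The action `V ↦ Qᵀ (V ∘ R)` of the rotation `R` on square integrable vector fields. -/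
def rotField {θ : Real.Angle} (hR : MeasurePreserving (originRotate θ) P P) :
    VecField (Lp ℝ 2 P) →L[ℝ] VecField (Lp ℝ 2 P) :=
  (PiLp.continuousLinearEquiv 2 ℝ (fun _ : Fin 2 => Lp ℝ 2 P)).symm.toContinuousLinearMap ∘L
    ContinuousLinearMap.pi
      ![rotLp hR ∘L (θ.cos • PiLp.proj 2 (fun _ : Fin 2 => Lp ℝ 2 P) 0 +
          θ.sin • PiLp.proj 2 (fun _ : Fin 2 => Lp ℝ 2 P) 1),
        rotLp hR ∘L (-θ.sin • PiLp.proj 2 (fun _ : Fin 2 => Lp ℝ 2 P) 0 +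
          θ.cos • PiLp.proj 2 (fun _ : Fin 2 => Lp ℝ 2 P) 1)]

theorem rotField_zero {θ : Real.Angle} (hR : MeasurePreserving (originRotate θ) P P)
    (V : VecField (Lp ℝ 2 P)) :
    rotField hR V 0 = rotLp hR (θ.cos • V 0 + θ.sin • V 1) := rfl

theorem rotField_one {θ : Real.Angle} (hR : MeasurePreserving (originRotate θ) P P)
    (V : VecField (Lp ℝ 2 P)) :
    rotField hR V 1 = rotLp hR (-θ.sin • V 0 + θ.cos • V 1) := rfl

/-- The rotation maps gradients to gradients: `𝔻(u ∘ R) = Qᵀ (𝔻u ∘ R)`. -/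
theorem rotField_mem_potential (hP : IsAdmissible P) {θ : Real.Angle}
    (hR : MeasurePreserving (originRotate θ) P P)
    {z : WithLp 2 (Lp ℝ 2 P × VecField (Lp ℝ 2 P))} (hz : z ∈ gradGraph (shift hP)) :
    rotField hR z.snd ∈ potential (shift hP) := by
  have hcs : θ.cos ^ 2 + θ.sin ^ 2 = 1 := θ.cos_sq_add_sin_sq
  have hU := isUnitaryRep_shift hP
  have hmem : WithLp.toLp 2 (rotLp hR z.fst, rotField hR z.snd) ∈ gradGraph (shift hP) := by
    intro i
    fin_cases i
    · have h1 := (((hz 0).smul_dir θ.cos).add_dir hU ((hz 1).smul_dir θ.sin)).rotLp hP hR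
      have h2 : rotInv θ (θ.cos • basisVec 0 + θ.sin • basisVec 1) = basisVec 0 := by
        ext k
        fin_cases k
        · simp [rotInv_apply_zero, basisVec]
          linear_combination hcs
        · simp [rotInv_apply_one, basisVec]
          ring
      rw [h2] at h1
      exact h1
    · have h1 := (((hz 0).smul_dir (-θ.sin)).add_dir hU ((hz 1).smul_dir θ.cos)).rotLp hP hR
      have h2 : rotInv θ (-θ.sin • basisVec 0 + θ.cos • basisVec 1) = basisVec 1 := by
        ext k
        fin_cases k
        · simp [rotInv_apply_zero, basisVec]
          ring
        · simp [rotInv_apply_one, basisVec]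
          linear_combination hcs
      rw [h2] at h1
      exact h1
  exact snd_mem_potential hmem

theorem rotLp_oneLp [IsFiniteMeasure P] {θ : Real.Angle}
    (hR : MeasurePreserving (originRotate θ) P P) : rotLp hR (oneLp P) = oneLp P := rfl

theorem rotField_constField [IsFiniteMeasure P] {θ : Real.Angle}
    (hR : MeasurePreserving (originRotate θ) P P) (ξ : Fin 2 → ℝ) :
    rotField hR (constField (oneLp P) ξ) = constField (oneLp P)
      ![θ.cos * ξ 0 + θ.sin * ξ 1, -θ.sin * ξ 0 + θ.cos * ξ 1] := by
  ext1 i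
  fin_cases i
  · change rotField hR (constField (oneLp P) ξ) 0 = (θ.cos * ξ 0 + θ.sin * ξ 1) • oneLp P
    rw [rotField_zero, constField_apply, constField_apply, smul_smul, smul_smul, ← add_smul,
      map_smul, rotLp_oneLp]
  · change rotField hR (constField (oneLp P) ξ) 1 = (-θ.sin * ξ 0 + θ.cos * ξ 1) • oneLp P
    rw [rotField_one, constField_apply, constField_apply, smul_smul, smul_smul, ← add_smul,
      map_smul, rotLp_oneLp]

theorem integral_comp_measurePreserving {Ω : Type*} [MeasurableSpace Ω] {μ : Measure Ω}
    {R : Ω → Ω} (hR : MeasurePreserving R μ μ) {φ : Ω → ℝ} (hφ : AEStronglyMeasurable φ μ) :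
    ∫ ω, φ (R ω) ∂μ = ∫ ω, φ ω ∂μ := by
  have h := integral_map hR.measurable.aemeasurable (f := φ) (by rwa [hR.map_eq])
  rw [hR.map_eq] at h
  exact h.symm

/-- The rotation preserves the energy. -/
theorem inner_rotField (hP : IsAdmissible P) {θ : Real.Angle}
    (hR : MeasurePreserving (originRotate θ) P P) (X : VecField (Lp ℝ 2 P)) :
    inner ℝ (rotField hR X) (envOp hP (rotField hR X)) = inner ℝ X (envOp hP X) := by
  rw [envOp, inner_matLp, inner_matLp]
  rw [← integral_comp_measurePreserving hR
    (integrable_matLp (memLp_envCoeff hP) X X).aestronglyMeasurable]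
  refine integral_congr_ae ?_
  have hlin : ∀ a b : ℝ, rotLp hR (a • X 0 + b • X 1) =ᵐ[P]
      fun h => a * X 0 (originRotate θ h) + b * X 1 (originRotate θ h) := fun a b => by
    filter_upwards [coeFn_rotLp hR (a • X 0 + b • X 1),
      hR.quasiMeasurePreserving.ae (Lp.coeFn_add (a • X 0) (b • X 1)),
      hR.quasiMeasurePreserving.ae (Lp.coeFn_smul a (X 0)),
      hR.quasiMeasurePreserving.ae (Lp.coeFn_smul b (X 1))] with h h1 h2 h3 h4
    rw [h1, h2, Pi.add_apply, h3, h4]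
    rfl
  filter_upwards [hlin θ.cos θ.sin, hlin (-θ.sin) θ.cos] with h h2 h3
  exact envCoeff_originRotate θ h (fun i => X i (originRotate θ h)) (fun i => rotField hR X i h)
    h2 h3

end Rotation

/-! ### The effective diffusion tensor -/

section EffectiveDiffusion

variable {P : Measure Field} [IsProbabilityMeasure P]

theorem vecLp_const (i : Fin 2) : vecLp (memLp_const (μ := P) (basisVec i)) =
    constField (oneLp P) (Pi.single i 1) := by
  ext1 k
  rw [constField_apply, oneLp, ← MemLp.toLp_const_smul, vecLp_apply]
  refine MemLp.toLp_congr _ _ (Eventually.of_forall fun h => ?_)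
  fin_cases i <;> fin_cases k <;> simp [basisVec]

theorem integral_diffusionIntegrand (hP : IsAdmissible P) {V : Fin 2 → Field → Plane}
    (hV : ∀ i, MemLp (V i) 2 P) (i j : Fin 2) :
    ∫ h, diffusionIntegrand V h i j ∂P =
      inner ℝ (constField (oneLp P) (Pi.single i 1) + vecLp (hV i))
        (envOp hP (constField (oneLp P) (Pi.single j 1) + vecLp (hV j))) := by
  rw [← vecLp_const, ← vecLp_const, ← vecLp_add, ← vecLp_add, envOp, inner_matLp_vecLp]
  congr 1
  funext h
  have hone : ∀ i k : Fin 2, (1 : Matrix (Fin 2) (Fin 2) ℝ) i k = basisVec i k := fun i k => by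
    fin_cases i <;> fin_cases k <;> simp [basisVec]
  simp only [diffusionIntegrand, Matrix.smul_apply, Matrix.mul_apply, Matrix.transpose_apply,
    Matrix.add_apply, gradMatrix, Matrix.of_apply, hone, envCoeff, ← areaElement_mul_inv,
    Fin.sum_univ_two, Pi.add_apply, PiLp.add_apply, smul_eq_mul]
  ring

/-- The homogenized matrix `Z D` is the identity. -/
theorem integral_diffusionIntegrand_eq_one (hP : IsAdmissible P) {θ : Real.Angle} (hθ0 : θ ≠ 0)
    (hθπ : θ ≠ (Real.pi : Real.Angle)) (hR : MeasurePreserving (originRotate θ) P P)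
    {V : Fin 2 → Field → Plane} (hV : ∀ i, IsCorrectorGradient P (basisVec i) (V i))
    (i j : Fin 2) :
    ∫ h, diffusionIntegrand V h i j ∂P = if i = j then 1 else 0 := by
  have hcor : IsCorrected (shift hP) (envOp hP) (oneLp P) fun i => vecLp (hV i).1 :=
    ⟨fun i => ((isCorrectorGradient_iff hP i (hV i).1).1 (hV i)).1,
      fun i => ((isCorrectorGradient_iff hP i (hV i).1).1 (hV i)).2⟩
  have hs : θ.sin ≠ 0 := fun h => (Real.Angle.sin_eq_zero_iff.1 h).elim hθ0 hθπ
  have hiso := isotropic_of_symmetry (isElliptic_envOp hP) hcor (rotField hR)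
    (fun z hz => rotField_mem_potential hP hR hz) (inner_rotField hP hR) hs
    θ.cos_sq_add_sin_sq (rotField_constField hR)
  have hone := eq_one_of_duality (isUnitaryRep_shift hP) (shift_oneLp hP) norm_oneLp
    (exists_eq_smul_oneLp hP) (isElliptic_envOp hP) (envOp_quarterTurn hP) hcor hiso
  rw [integral_diffusionIntegrand hP (fun i => (hV i).1), hiso, hone]

theorem exists_correctorGradient (hP : IsAdmissible P) (i : Fin 2) :
    ∃ V, IsCorrectorGradient P (basisVec i) V := by
  obtain ⟨W, hW, hWo⟩ := exists_potential_corrector (U := shift hP) (isElliptic_envOp hP)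
    (constField (oneLp P) (Pi.single i 1))
  obtain ⟨V, hV, rfl⟩ := exists_vecLp_eq W
  exact ⟨V, (isCorrectorGradient_iff hP i hV).2 ⟨hW, hWo⟩⟩

theorem isEffectiveDiffusion_iff (hP : IsAdmissible P) {θ : Real.Angle} (hθ0 : θ ≠ 0)
    (hθπ : θ ≠ (Real.pi : Real.Angle)) (hR : MeasurePreserving (originRotate θ) P P)
    (D : Matrix (Fin 2) (Fin 2) ℝ) :
    IsEffectiveDiffusion P D ↔ D = (avgArea P)⁻¹ • (1 : Matrix (Fin 2) (Fin 2) ℝ) := by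
  have hentry : ∀ i j : Fin 2, ((avgArea P)⁻¹ • (1 : Matrix (Fin 2) (Fin 2) ℝ)) i j =
      (avgArea P)⁻¹ * if i = j then 1 else 0 := fun i j => by
    rw [Matrix.smul_apply, Matrix.one_apply, smul_eq_mul]
  constructor
  · rintro ⟨V, hV, hD⟩
    ext i j
    rw [hD, integral_diffusionIntegrand_eq_one hP hθ0 hθπ hR hV, hentry]
  · rintro rfl
    choose V hV using exists_correctorGradient hP
    refine ⟨V, hV, fun i j => ?_⟩
    rw [integral_diffusionIntegrand_eq_one hP hθ0 hθπ hR hV, hentry]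

theorem rotMatrix_mul_transpose (θ : Real.Angle) : rotMatrix θ * (rotMatrix θ)ᵀ = 1 := by
  have hcs := θ.cos_sq_add_sin_sq
  ext i j
  fin_cases i <;> fin_cases j <;> simp [rotMatrix, Matrix.mul_apply, Fin.sum_univ_two] <;>
    linarith

end EffectiveDiffusion

end RandomSurface

end

theorem theorem6p3 (P : MeasureTheory.Measure RandomSurface.Field)
    (hP : RandomSurface.IsAdmissible P)
    (θ : Real.Angle) (hθ0 : θ ≠ 0) (hθπ : θ ≠ (Real.pi : Real.Angle))
    (c : RandomSurface.Plane)
    (hinv : ∀ B : Set RandomSurface.Field, MeasurableSet B →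
      P (RandomSurface.rotate (RandomSurface.rotMatrix θ) c ⁻¹' B) = P B) :
    (∃! D : Matrix (Fin 2) (Fin 2) ℝ, RandomSurface.IsEffectiveDiffusion P D) ∧
    ∀ D : Matrix (Fin 2) (Fin 2) ℝ, RandomSurface.IsEffectiveDiffusion P D →
      D = RandomSurface.rotMatrix θ * D * (RandomSurface.rotMatrix θ)ᵀ ∧
      (∃ a : ℝ, D = a • (1 : Matrix (Fin 2) (Fin 2) ℝ)) ∧
      D = (RandomSurface.avgArea P)⁻¹ • (1 : Matrix (Fin 2) (Fin 2) ℝ) := by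
  have := hP.prob
  have hiff := RandomSurface.isEffectiveDiffusion_iff hP hθ0 hθπ
    (RandomSurface.measurePreserving_originRotate hP hinv)
  refine ⟨⟨_, (hiff _).2 rfl, fun D hD => (hiff D).1 hD⟩, fun D hD => ?_⟩
  have hD' := (hiff D).1 hD
  refine ⟨?_, ⟨_, hD'⟩, hD'⟩
  rw [hD', Matrix.mul_smul, Matrix.mul_one, Matrix.smul_mul,
    RandomSurface.rotMatrix_mul_transpose]
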